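/- **Setting.** Let $K\ge 1$ and let $\nu_1,\dots,\nu_K$ be probability distributions on $[0,1]$ with means $\mu_1,\dots,\mu_K$; put $\mu^*=\max_a\mu_a$ and $\Delta_a=\mu^*-\mu_a$. In round $t=1,2,\dots$ an arm $a_t$ is played and a reward drawn from $\nu_{a_t}$, independently of the past, is observed. For $\epsilon\in[0,1]$, a function $f:[0,1]\to[0,\infty)$ is an *$\epsilon$-gap function* if $f(\Delta)=0$ for $\Delta\in[0,\epsilon]$ and $f(\Delta)>0$ for $\Delta\in(\epsilon,1]$. The *lenient regret* is $R_f(T)=\mathbb E\big[\sum_{t=1}^T f(\Delta_{a_t})\big]$. Let $d(p,q)=p\ln\frac pq+(1-p)\ln\frac{1-p}{1-q}$, with $d(p,q)=\infty$ if $p<1\le q$ or $p>0=q$. **The algorithm $\epsilon$-TS.** A reward $x\in[0,1]$ is replaced by $1$ with probability $x$ and by $0$ with probability $1-x$ (which changes nothing for rewards in $\{0,1\}$). Before round $t$ let $N_a$ be the number of plays of arm $a$ so far, $S_a$ the sum of its rounded rewards, and $\hat\mu_a=S_a/N_a$ ($\hat\mu_a=0$ if $N_a=0$). Given the past, draw independently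 for every arm $a$ an index $\theta_a$: if $\hat\mu_a>1-\epsilon$, then $\theta_a=\hat\mu_a$; otherwise $\theta_a=(1-\epsilon)Y_a$ with $Y_a\sim\mathrm{Beta}(\alpha_a,\,N_a+2-\alpha_a)$, $\alpha_a=\lfloor S_a/(1-\epsilon)\rfloor+1$ (with $0/0=0$ if $\epsilon=1$). Play an arm that maximizes $\theta_a$, ties being broken uniformly at random. **Theorem.** Let $f$ be an $\epsilon$-gap function, and let $R_f(T)$ be the lenient regret of $\epsilon$-TS. 1. $$\limsup_{T\to\infty}\frac{R_f(T)}{\ln T}\le U:=\sum_{a:\Delta_a>\epsilon}\frac{f(\Delta_a)}{d\big(\frac{\mu_a}{1-\epsilon},\frac{\mu^*}{1-\epsilon}\big)} .$$ 2. There is an absolute constant $C$ such that always $$U\le C\sum_{a:\Delta_a>\epsilon}\frac{f(\Delta_a)}{d(\mu_a,\mu^*+\epsilon)} .$$ Moreover, for Bernoulli arms and any set $\mathcal D$ of probability distributions on $[0,1]$ that contains all Bernoulli distributions, $$U\le C\sum_{a:\Delta_a>\epsilon}\frac{f(\Delta_a)}{\mathcal K_{\inf}(\nu_a,\mu^*+\epsilon,\mathcal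 D)},\qquad \mathcal K_{\inf}(\nu,x,\mathcal D)=\inf\{\mathrm{KL}(\nu,\nu'):\nu'\in\mathcal D,\ \mathbb E[\nu']>x\}\quad(\inf\emptyset=\infty),$$ that is, $U$ matches, up to an absolute constant, the known asymptotic lower bound (the sum on the right) on $R_f(T)/\ln T$ for strategies consistent over $\mathcal D$. 3. If $\mu^*>1-\epsilon$, then $R_f(T)=O(1)$ as $T\to\infty$; more precisely $R_f(T)\le M\max_a f(\Delta_a)$ for all $T$, where $M$ depends only on $\epsilon$ and the means $\mu_1,\dots,\mu_K$. -/

import Mathlib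

open MeasureTheory ProbabilityTheory Filter
open scoped ENNReal NNReal

noncomputable section

namespace LenientBandit

/-- The Bernoulli relative entropy `d(p, q)`, with values in `[0, ∞]`.
It is `∞` if `p < 1 ≤ q`, or if `q = 0 < p`; the convention `0 * log 0 = 0` is built in. -/
def bernKL (p q : ℝ) : ℝ≥0∞ :=
  if (p < 1 ∧ 1 ≤ q) ∨ (0 < p ∧ q = 0) then ∞
  else ENNReal.ofReal (p * Real.log (p / q) + (1 - p) * Real.log ((1 - p) / (1 - q)))

/-- `f` (of which only the restriction to `[0, 1]` matters) is an `ε`-gap function. -/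
structure IsGapFunction (ε : ℝ) (f : ℝ → ℝ) : Prop where
  eps_mem : ε ∈ Set.Icc (0 : ℝ) 1
  eq_zero : ∀ δ ∈ Set.Icc (0 : ℝ) ε, f δ = 0
  pos : ∀ δ ∈ Set.Ioc ε 1, 0 < f δ

/-- A probability distribution supported in `[0, 1]`. -/
structure IsUnitLaw (ν : Measure ℝ) : Prop where
  prob : IsProbabilityMeasure ν
  supp : ∀ᵐ x ∂ν, x ∈ Set.Icc (0 : ℝ) 1

/-- A stochastic bandit problem with `K` arms and rewards in `[0, 1]`. -/
structure Bandit (K : ℕ) where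
  law : Fin K → Measure ℝ
  isUnitLaw : ∀ a, IsUnitLaw (law a)

/-- A play history, most recent round first: the arm played, and whether the
(randomly rounded) reward was one. -/
abbrev History (K : ℕ) := List (Fin K × Bool)

/-- The number of past plays of arm `a`. -/
def pulls {K : ℕ} (h : History K) (a : Fin K) : ℕ := h.countP (fun r => r.1 = a)

/-- The sum of the past (rounded) rewards of arm `a`. -/
def successes {K : ℕ} (h : History K) (a : Fin K) : ℕ := h.countP (fun r => r.1 = a ∧ r.2 = true)

/-- The empirical mean of arm `a`; it is `0 / 0 = 0` if `a` has not been played. -/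
def empMean {K : ℕ} (h : History K) (a : Fin K) : ℝ := (successes h a : ℝ) / (pulls h a : ℝ)

/-- The first parameter of the Beta posterior. -/
def alphaParam {K : ℕ} (ε : ℝ) (h : History K) (a : Fin K) : ℝ :=
  (⌊(successes h a : ℝ) / (1 - ε)⌋₊ : ℝ) + 1

/-- The second parameter of the Beta posterior. -/
def betaParam {K : ℕ} (ε : ℝ) (h : History K) (a : Fin K) : ℝ :=
  (pulls h a : ℝ) + 2 - alphaParam ε h a

open Classical in
/-- The law of the index `θ_a` that `ε`-TS draws for arm `a` after the history `h`. -/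
def posterior {K : ℕ} (ε : ℝ) (h : History K) (a : Fin K) : Measure ℝ :=
  if 1 - ε < empMean h a then Measure.dirac (empMean h a)
  else (betaMeasure (alphaParam ε h a) (betaParam ε h a)).map (fun y => (1 - ε) * y)

lemma successes_le_pulls {K : ℕ} (h : History K) (a : Fin K) : successes h a ≤ pulls h a := by
  refine List.countP_mono_left ?_
  intro x _ hx
  simp only [decide_eq_true_eq] at hx ⊢
  exact hx.1

lemma betaParam_pos {K : ℕ} (ε : ℝ) (h : History K) (a : Fin K)
    (hh : ¬ 1 - ε < empMean h a) : 0 < betaParam ε h a := by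
  have hle := successes_le_pulls h a
  have key : ⌊(successes h a : ℝ) / (1 - ε)⌋₊ ≤ pulls h a := by
    refine Nat.floor_le_of_le ?_
    rw [not_lt, empMean] at hh
    have h0 : 0 ≤ (successes h a : ℝ) / (pulls h a : ℝ) := by positivity
    rcases (h0.trans hh).eq_or_lt with h1 | h1
    · rw [← h1]; simp
    · rw [div_le_iff₀ h1]
      rcases Nat.eq_zero_or_pos (pulls h a) with h2 | h2
      · have : successes h a = 0 := by omega
        simp [this, h2]
      · have h3 : (0 : ℝ) < pulls h a := by exact_mod_cast h2
        rw [div_le_iff₀ h3] at hh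
        linarith
  have key' : (⌊(successes h a : ℝ) / (1 - ε)⌋₊ : ℝ) ≤ pulls h a := by exact_mod_cast key
  unfold betaParam alphaParam
  linarith

instance posterior_isProbabilityMeasure {K : ℕ} (ε : ℝ) (h : History K) (a : Fin K) :
    IsProbabilityMeasure (posterior ε h a) := by
  unfold posterior
  split_ifs with hh
  · infer_instance
  · have h1 : 0 < alphaParam ε h a := by unfold alphaParam; positivity
    have := isProbabilityMeasureBeta h1 (betaParam_pos ε h a hh)
    exact Measure.isProbabilityMeasure_map (by fun_prop)

/-- The set of maximizers of an index vector. -/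
def argmaxSet {K : ℕ} (θ : Fin K → ℝ) : Finset (Fin K) :=
  open Classical in Finset.univ.filter (fun a => ∀ b, θ b ≤ θ a)

lemma argmaxSet_nonempty {K : ℕ} [NeZero K] (θ : Fin K → ℝ) : (argmaxSet θ).Nonempty := by
  obtain ⟨a, -, ha⟩ := Finset.exists_max_image Finset.univ θ Finset.univ_nonempty
  exact ⟨a, by simpa [argmaxSet] using ha⟩

/-- The arm played given the index vector `θ`: uniform on the maximizers of `θ`. -/
def tieBreak {K : ℕ} [NeZero K] (θ : Fin K → ℝ) : PMF (Fin K) :=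
  PMF.uniformOfFinset (argmaxSet θ) (argmaxSet_nonempty θ)

lemma measurable_argmaxSet {K : ℕ} : Measurable[_, ⊤] (argmaxSet (K := K)) := by
  classical
  have : ∀ s : Finset (Fin K), MeasurableSet {θ : Fin K → ℝ | argmaxSet θ = s} := by
    intro s
    have hs : {θ : Fin K → ℝ | argmaxSet θ = s}
        = ⋂ a : Fin K, {θ | (∀ b, θ b ≤ θ a) ↔ a ∈ s} := by
      ext θ
      simp [Finset.ext_iff, argmaxSet]
    rw [hs]
    refine MeasurableSet.iInter fun a => ?_
    have hm : MeasurableSet {θ : Fin K → ℝ | ∀ b, θ b ≤ θ a} := by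
      rw [Set.ofPred_forall]
      exact MeasurableSet.iInter fun b =>
        measurableSet_le (measurable_pi_apply b) (measurable_pi_apply a)
    by_cases ha : a ∈ s
    · simpa [ha] using hm
    · simp only [ha, iff_false]
      exact hm.compl
  let _ : MeasurableSpace (Finset (Fin K)) := ⊤
  exact measurable_to_countable' fun s => this s

lemma measurable_tieBreak {K : ℕ} [NeZero K] (a : Fin K) :
    Measurable (fun θ : Fin K → ℝ => tieBreak θ a) := by
  classical
  have : (fun θ : Fin K → ℝ => tieBreak θ a)
      = (fun s : Finset (Fin K) => if a ∈ s then (s.card : ℝ≥0∞)⁻¹ else 0) ∘ argmaxSet := by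
    funext θ
    simp [tieBreak]
  rw [this]
  let _ : MeasurableSpace (Finset (Fin K)) := ⊤
  exact (measurable_from_top).comp measurable_argmaxSet

/-- The law of the arm played by `ε`-TS after the history `h`: the indices `θ_a` are drawn
independently from the posteriors, and a maximizer is played, ties being broken uniformly. -/
def playLaw {K : ℕ} [NeZero K] (ε : ℝ) (h : History K) : PMF (Fin K) :=
  PMF.ofFintype (fun a => ∫⁻ θ, tieBreak θ a ∂(Measure.pi (posterior ε h))) (by
    rw [← lintegral_finsetSum _ (fun a _ => measurable_tieBreak a)]
    have h1 : ∀ θ : Fin K → ℝ, ∑ a, tieBreak θ a = 1 := fun θ => by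
      rw [← tsum_fintype (L := .unconditional _)]; exact (tieBreak θ).tsum_coe
    simp [h1])

namespace Bandit

variable {K : ℕ}

/-- The law of the rounded reward of arm `a`: a reward `X` is drawn from the law of the arm
and, given `X`, it is rounded to one with probability `X` and to zero with probability `1 - X`.
For a reward with values in `{0, 1}` this changes nothing. -/
def rewardLaw (B : Bandit K) (a : Fin K) : PMF Bool :=
  PMF.ofFintype (fun b => ∫⁻ x, ENNReal.ofReal (if b then x else 1 - x) ∂(B.law a)) (by
    have := (B.isUnitLaw a).prob
    rw [Fintype.sum_bool, ← lintegral_add_left (by simp only [if_true]; fun_prop)]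
    rw [lintegral_congr_ae (g := fun _ => 1), lintegral_const, measure_univ, mul_one]
    filter_upwards [(B.isUnitLaw a).supp] with x hx
    rw [← ENNReal.ofReal_add (by simpa using hx.1) (by simpa using hx.2)]
    simp)

/-- The mean reward of arm `a`. -/
def mean (B : Bandit K) (a : Fin K) : ℝ := ∫ x, x ∂(B.law a)

/-- The mean of an optimal arm. -/
def optMean (B : Bandit K) : ℝ := ⨆ a, B.mean a

/-- The suboptimality gap of arm `a`. -/
def gap (B : Bandit K) (a : Fin K) : ℝ := B.optMean - B.mean a

/-- The joint law of the arms played and the rewards observed by `ε`-TS in the first `t` rounds. -/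
def runLaw [NeZero K] (B : Bandit K) (ε : ℝ) : ℕ → PMF (History K)
  | 0 => PMF.pure []
  | t + 1 => (B.runLaw ε t).bind fun h =>
      (playLaw ε h).bind fun a => (B.rewardLaw a).bind fun x => PMF.pure ((a, x) :: h)

/-- The lenient regret `R_f(T)` of `ε`-TS with respect to `f`: the expectation of
`∑_{t ≤ T} f(Δ_{a_t})`. (The law of the first `T` rounds has finite support.) -/
def lenientRegret [NeZero K] (B : Bandit K) (ε : ℝ) (f : ℝ → ℝ) (T : ℕ) : ℝ :=
  ∑' h : History K, (B.runLaw ε T h).toReal * (h.map fun r => f (B.gap r.1)).sum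

/-- The sum of `f(Δ_a) / D a` over the arms with `Δ_a > ε`. -/
def gapSum (B : Bandit K) (ε : ℝ) (f : ℝ → ℝ) (D : Fin K → ℝ≥0∞) : ℝ≥0∞ :=
  open Classical in ∑ a with ε < B.gap a, ENNReal.ofReal (f (B.gap a)) / D a

end Bandit

/-- `K_inf(ν, x, D)`: the infimum of `KL(ν, ν')` over the distributions `ν'` of `D` with mean
greater than `x`; it is `∞` if there are none. -/
def kInf (ν : Measure ℝ) (x : ℝ) (D : Set (Measure ℝ)) : ℝ≥0∞ :=
  ⨅ ν' ∈ D, ⨅ _ : x < ∫ y, y ∂ν', InformationTheory.klDiv ν ν'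

end LenientBandit

end

noncomputable section

namespace LenientBandit

/-! ### Basic facts on the means -/

namespace Bandit

variable {K : ℕ}

/-! Fix an arm a with gap above ε, an optimal arm o and a threshold y. The event that all indices
are at most y is compared with the event that o exceeds y and the others do not. This bounds the
chance of playing a by the odds that o falls below y, times the chance of playing o, plus the chance
that the index of a exceeds y (`playProb_le_aux`). Sums over rounds are then bounded by potentials
in the counts of one or two arms (`total_play_le_of_potential`); the history-dependent play
probabilities drop out and only i.i.d. Bernoulli trials remain.

Beta tails are binomial sums (`betaMeasure_Ioi`). While the empirical mean of a stays below some z >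
μ_a, the Chernoff bound with the optimal tilt shows that its index exceeds y with probability at
most exp(-N_a d(z/(1-ε), y/(1-ε))), hence at most 1/T after ln T / d plays; overestimation of a
costs O(1). Two estimates handle o. If y/(1-ε) < μ*, a change of measure from μ* to y/(1-ε) bounds
the total loss by a constant (`exists_total_lowOdds_le`). Such y exist above μ_a because μ_a <
(1-ε)μ*, but they do not give the sharp constant; they only show that the first O(ln T) plays of a
matter. For y up to μ*, the odds decay geometrically in N_o unless o has at least m plays and an
empirical mean below some w < μ*. Over the first O(ln T) plays of a, that event costs O(ln T) times
a factor exponentially small in m (`total_underestimated_le`). Letting m grow, y → μ* and z → μ_a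
gives the logarithmic bound (`eventually_total_play_le`).

If μ* > 1-ε, three cases give boundedness (`exists_total_play_le`), apart from overestimation of a.
If the empirical mean of o exceeds 1-ε, then a cannot win. If it does not and N_a is less than a
constant times N_o + 1, the underestimation of o is exponentially unlikely in N_o, hence in N_a.
Otherwise a is explored so much more than o that its posterior beyond y is at most a multiple of
2^(-N_o) of that of o (`exists_posterior_dominated`), so plays of a are charged to plays of o.

The order of magnitude rests on d(p, q+ε) ≤ 4 d(p/(1-ε), q/(1-ε)) for q - p > ε
(`klReal_add_le_four_mul`), proved by comparing derivatives along a path. -/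

lemma integrable_law (B : Bandit K) (a : Fin K) : Integrable (fun x : ℝ => x) (B.law a) := by
  have := (B.isUnitLaw a).prob
  refine Integrable.of_bound (C := 1) (by fun_prop) ?_
  filter_upwards [(B.isUnitLaw a).supp] with x hx
  rw [Real.norm_eq_abs, abs_of_nonneg hx.1]
  exact hx.2

lemma mean_nonneg (B : Bandit K) (a : Fin K) : 0 ≤ B.mean a :=
  integral_nonneg_of_ae (by filter_upwards [(B.isUnitLaw a).supp] with x hx using hx.1)

lemma mean_le_one (B : Bandit K) (a : Fin K) : B.mean a ≤ 1 := by
  have := (B.isUnitLaw a).prob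
  have h : B.mean a ≤ ∫ _, (1 : ℝ) ∂(B.law a) :=
    integral_mono_ae (B.integrable_law a) (integrable_const _)
      (by filter_upwards [(B.isUnitLaw a).supp] with x hx using hx.2)
  simpa using h

lemma mean_le_optMean (B : Bandit K) (a : Fin K) : B.mean a ≤ B.optMean :=
  le_ciSup (Set.finite_range _).bddAbove a

lemma exists_mean_eq_optMean [NeZero K] (B : Bandit K) : ∃ a, B.mean a = B.optMean :=
  exists_eq_ciSup_of_finite

lemma optMean_le_one [NeZero K] (B : Bandit K) : B.optMean ≤ 1 := by
  obtain ⟨a, ha⟩ := B.exists_mean_eq_optMean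
  exact ha ▸ B.mean_le_one a

lemma gap_nonneg (B : Bandit K) (a : Fin K) : 0 ≤ B.gap a :=
  sub_nonneg.2 (B.mean_le_optMean a)

lemma gap_le_one [NeZero K] (B : Bandit K) (a : Fin K) : B.gap a ≤ 1 := by
  have := B.optMean_le_one
  have := B.mean_nonneg a
  unfold gap
  linarith

/-- Rounding preserves the mean, so the run sees only Bernoulli rewards and depends on the arms
through their means alone. -/
lemma rewardLaw_true (B : Bandit K) (a : Fin K) :
    B.rewardLaw a true = ENNReal.ofReal (B.mean a) := by
  rw [mean, ofReal_integral_eq_lintegral_ofReal (B.integrable_law a)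
    (by filter_upwards [(B.isUnitLaw a).supp] with x hx using hx.1)]
  simp [rewardLaw]

lemma rewardLaw_false (B : Bandit K) (a : Fin K) :
    B.rewardLaw a false = ENNReal.ofReal (1 - B.mean a) := by
  have h := (B.rewardLaw a).tsum_coe
  rw [tsum_fintype, Fintype.sum_bool, rewardLaw_true] at h
  rw [ENNReal.ofReal_sub _ (B.mean_nonneg a), ENNReal.ofReal_one, ← h,
    ENNReal.add_sub_cancel_left ENNReal.ofReal_ne_top]

end Bandit

lemma IsGapFunction.nonneg {K : ℕ} [NeZero K] {ε : ℝ} {f : ℝ → ℝ} (hf : IsGapFunction ε f)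
    (B : Bandit K) (a : Fin K) : 0 ≤ f (B.gap a) := by
  rcases le_or_gt (B.gap a) ε with h | h
  · exact (hf.eq_zero _ ⟨B.gap_nonneg a, h⟩).ge
  · exact (hf.pos _ ⟨h, B.gap_le_one a⟩).le

/-! ### The one-step operator of the strategy -/

/-- The probability that `ε`-TS plays arm `a` after the history `h`. -/
def playProb {K : ℕ} [NeZero K] (ε : ℝ) (h : History K) (a : Fin K) : ℝ :=
  (playLaw ε h a).toReal

lemma playProb_nonneg {K : ℕ} [NeZero K] (ε : ℝ) (h : History K) (a : Fin K) :
    0 ≤ playProb ε h a := ENNReal.toReal_nonneg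

lemma sum_playProb {K : ℕ} [NeZero K] (ε : ℝ) (h : History K) :
    ∑ a, playProb ε h a = 1 := by
  have h1 := (playLaw ε h).tsum_coe
  rw [tsum_fintype] at h1
  simp only [playProb]
  rw [← ENNReal.toReal_sum (fun a _ => PMF.apply_ne_top _ _), h1, ENNReal.toReal_one]

namespace Bandit

variable {K : ℕ} [NeZero K]

/-- The conditional expectation of `φ` of the history one round later. -/
def step (B : Bandit K) (ε : ℝ) (φ : History K → ℝ) (h : History K) : ℝ :=
  ∑ a, playProb ε h a *
    (B.mean a * φ ((a, true) :: h) + (1 - B.mean a) * φ ((a, false) :: h))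

/-- The expectation of the sum of `ψ` over the histories before the first `T` rounds. -/
def total (B : Bandit K) (ε : ℝ) (T : ℕ) (ψ : History K → ℝ) : ℝ :=
  ∑ t ∈ Finset.range T, ((B.step ε)^[t] ψ) []

lemma step_mono (B : Bandit K) (ε : ℝ) {φ ψ : History K → ℝ} (h : ∀ x, φ x ≤ ψ x)
    (x : History K) : B.step ε φ x ≤ B.step ε ψ x := by
  refine Finset.sum_le_sum fun a _ => mul_le_mul_of_nonneg_left ?_ (playProb_nonneg _ _ _)
  have h0 := B.mean_nonneg a
  have h1 := sub_nonneg.2 (B.mean_le_one a)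
  gcongr <;> exact h _

lemma step_add (B : Bandit K) (ε : ℝ) (φ ψ : History K → ℝ) :
    B.step ε (fun h => φ h + ψ h) = fun h => B.step ε φ h + B.step ε ψ h := by
  funext h
  simp only [step, ← Finset.sum_add_distrib]
  exact Finset.sum_congr rfl fun a _ => by ring

lemma step_const (B : Bandit K) (ε : ℝ) (c : ℝ) (h : History K) :
    B.step ε (fun _ => c) h = c := by
  have : ∀ a, playProb ε h a * (B.mean a * c + (1 - B.mean a) * c) = playProb ε h a * c :=
    fun a => by ring
  simp only [step, this, ← Finset.sum_mul, sum_playProb, one_mul]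

lemma step_const_mul (B : Bandit K) (ε : ℝ) (c : ℝ) (φ : History K → ℝ) :
    B.step ε (fun h => c * φ h) = fun h => c * B.step ε φ h := by
  funext h
  simp only [step, Finset.mul_sum]
  exact Finset.sum_congr rfl fun a _ => by ring

lemma iterate_step_mono (B : Bandit K) (ε : ℝ) {φ ψ : History K → ℝ} (h : ∀ x, φ x ≤ ψ x)
    (t : ℕ) : ∀ x, (B.step ε)^[t] φ x ≤ (B.step ε)^[t] ψ x := by
  induction t with
  | zero => exact h
  | succ t ih =>
    intro x
    simp only [Function.iterate_succ_apply']
    exact B.step_mono ε ih x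

lemma iterate_step_add (B : Bandit K) (ε : ℝ) (φ ψ : History K → ℝ) (t : ℕ) :
    (B.step ε)^[t] (fun h => φ h + ψ h)
      = fun h => (B.step ε)^[t] φ h + (B.step ε)^[t] ψ h := by
  induction t with
  | zero => rfl
  | succ t ih => simp only [Function.iterate_succ_apply', ih, step_add]

lemma iterate_step_const_mul (B : Bandit K) (ε : ℝ) (c : ℝ) (φ : History K → ℝ) (t : ℕ) :
    (B.step ε)^[t] (fun h => c * φ h) = fun h => c * (B.step ε)^[t] φ h := by
  induction t with
  | zero => rfl
  | succ t ih => simp only [Function.iterate_succ_apply', ih, step_const_mul]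

lemma iterate_step_const (B : Bandit K) (ε : ℝ) (c : ℝ) (t : ℕ) :
    (B.step ε)^[t] (fun _ => c) = fun _ => c := by
  induction t with
  | zero => rfl
  | succ t ih =>
    rw [Function.iterate_succ_apply', ih]
    exact funext fun h => B.step_const ε c h

lemma total_mono (B : Bandit K) (ε : ℝ) (T : ℕ) {φ ψ : History K → ℝ} (h : ∀ x, φ x ≤ ψ x) :
    B.total ε T φ ≤ B.total ε T ψ :=
  Finset.sum_le_sum fun t _ => B.iterate_step_mono ε h t []

lemma total_add (B : Bandit K) (ε : ℝ) (T : ℕ) (φ ψ : History K → ℝ) :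
    B.total ε T (fun h => φ h + ψ h) = B.total ε T φ + B.total ε T ψ := by
  simp only [total, iterate_step_add, Finset.sum_add_distrib]

lemma total_const (B : Bandit K) (ε : ℝ) (T : ℕ) (c : ℝ) :
    B.total ε T (fun _ => c) = T * c := by
  simp [total, iterate_step_const]

lemma total_const_mul (B : Bandit K) (ε : ℝ) (T : ℕ) (c : ℝ) (φ : History K → ℝ) :
    B.total ε T (fun h => c * φ h) = c * B.total ε T φ := by
  simp only [total, iterate_step_const_mul, Finset.mul_sum]

lemma total_nonneg (B : Bandit K) (ε : ℝ) (T : ℕ) {φ : History K → ℝ} (h : ∀ x, 0 ≤ φ x) :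
    0 ≤ B.total ε T φ := by
  have := B.total_mono ε T (φ := fun _ => 0) h
  rwa [total_const, mul_zero] at this

/-- A sum along the run is at most the initial value of any potential that pays for it. -/
lemma total_le_of_potential (B : Bandit K) (ε : ℝ) {ψ : History K → ℝ}
    (Φ : ℕ → History K → ℝ) (h0 : ∀ h, 0 ≤ Φ 0 h)
    (hΦ : ∀ t h, ψ h + B.step ε (Φ t) h ≤ Φ (t + 1) h) (T : ℕ) :
    B.total ε T ψ ≤ Φ T [] := by
  suffices H : ∀ T h, ∑ t ∈ Finset.range T, ((B.step ε)^[t] ψ) h ≤ Φ T h from H T []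
  intro T
  induction T with
  | zero => simpa using h0
  | succ T ih =>
    intro h
    have hs : ∀ n, B.step ε (fun h => ∑ t ∈ Finset.range n, ((B.step ε)^[t] ψ) h) h
        = ∑ t ∈ Finset.range n, ((B.step ε)^[t + 1] ψ) h := by
      intro n
      induction n with
      | zero => simpa using B.step_const ε 0 h
      | succ n ihn =>
        simp only [Finset.sum_range_succ, step_add, ihn, Function.iterate_succ_apply']
    rw [Finset.sum_range_succ', ← hs, Function.iterate_zero_apply, add_comm]
    exact (add_le_add_right (B.step_mono ε ih h) _).trans (hΦ T h)

/-! ### The lenient regret through the one-step operator -/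

lemma tsum_bind_mul {α β : Type*} (p : PMF α) (q : α → PMF β) (φ : β → ℝ≥0∞) :
    ∑' b, (p.bind q) b * φ b = ∑' a, p a * ∑' b, q a b * φ b := by
  simp only [PMF.bind_apply, ← ENNReal.tsum_mul_right, ← ENNReal.tsum_mul_left]
  rw [ENNReal.tsum_comm]
  simp only [mul_assoc]

lemma tsum_pure_mul {α : Type*} (x : α) (φ : α → ℝ≥0∞) :
    ∑' b, (PMF.pure x) b * φ b = φ x := by
  rw [tsum_eq_single x (fun b hb => by simp [PMF.pure_apply, hb])]
  simp

lemma step_nonneg (B : Bandit K) (ε : ℝ) {φ : History K → ℝ} (h : ∀ x, 0 ≤ φ x)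
    (x : History K) : 0 ≤ B.step ε φ x := by
  have := B.step_mono ε h x
  rwa [step_const] at this

/-- Conditioning on the first `t` rounds turns `φ` into `step φ`. Nonnegativity keeps the sums in
`ℝ≥0∞`, where no summability has to be checked. -/
lemma tsum_runLaw (B : Bandit K) (ε : ℝ) (t : ℕ) : ∀ φ : History K → ℝ, (∀ h, 0 ≤ φ h) →
    ∑' h, B.runLaw ε t h * ENNReal.ofReal (φ h) = ENNReal.ofReal ((B.step ε)^[t] φ []) := by
  induction t with
  | zero =>
    intro φ _
    exact tsum_pure_mul ([] : History K) (fun h => ENNReal.ofReal (φ h))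
  | succ t ih =>
    intro φ hφ
    rw [Function.iterate_succ_apply, ← ih _ (B.step_nonneg ε hφ), runLaw, tsum_bind_mul]
    refine tsum_congr fun h => ?_
    congr 1
    rw [tsum_bind_mul, tsum_fintype, step, ENNReal.ofReal_sum_of_nonneg]
    · refine Finset.sum_congr rfl fun a _ => ?_
      have h0 := B.mean_nonneg a
      have h1 := sub_nonneg.2 (B.mean_le_one a)
      rw [tsum_bind_mul, tsum_fintype, Fintype.sum_bool, tsum_pure_mul, tsum_pure_mul,
        rewardLaw_true, rewardLaw_false, ← ENNReal.ofReal_mul h0, ← ENNReal.ofReal_mul h1,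
        ← ENNReal.ofReal_add (mul_nonneg h0 (hφ _)) (mul_nonneg h1 (hφ _)),
        ENNReal.ofReal_mul (playProb_nonneg _ _ _), playProb,
        ENNReal.ofReal_toReal (PMF.apply_ne_top _ _)]
    · intro a _
      have h0 := B.mean_nonneg a
      have h1 := sub_nonneg.2 (B.mean_le_one a)
      exact mul_nonneg (playProb_nonneg _ _ _)
        (add_nonneg (mul_nonneg h0 (hφ _)) (mul_nonneg h1 (hφ _)))

lemma iterate_step_nonneg (B : Bandit K) (ε : ℝ) {φ : History K → ℝ} (h : ∀ x, 0 ≤ φ x)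
    (t : ℕ) (x : History K) : 0 ≤ (B.step ε)^[t] φ x := by
  have := B.iterate_step_mono ε h t x
  rwa [iterate_step_const] at this

lemma lenientRegret_eq (B : Bandit K) (ε : ℝ) {f : ℝ → ℝ} (hf : ∀ a, 0 ≤ f (B.gap a)) (T : ℕ) :
    B.lenientRegret ε f T
      = ∑ a, f (B.gap a) * B.total ε T (fun h => playProb ε h a) := by
  set φ : History K → ℝ := fun h => (h.map fun r => f (B.gap r.1)).sum with hφ
  have hφ0 : ∀ h, 0 ≤ φ h := fun h =>
    List.sum_nonneg (by simp only [List.mem_map]; rintro _ ⟨r, -, rfl⟩; exact hf _)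
  have h1 : B.lenientRegret ε f T = (B.step ε)^[T] φ [] := by
    rw [← ENNReal.toReal_ofReal (B.iterate_step_nonneg ε hφ0 T []), ← B.tsum_runLaw ε T φ hφ0,
      ENNReal.tsum_toReal_eq
        (fun h => ENNReal.mul_ne_top (PMF.apply_ne_top _ _) ENNReal.ofReal_ne_top)]
    refine tsum_congr fun h => ?_
    rw [ENNReal.toReal_mul, ENNReal.toReal_ofReal (hφ0 h)]
  -- The accumulated regret is additive, so one step adds just the expected regret of the next play;
  -- iterating telescopes to a sum over rounds.
  have h2 : B.step ε φ = fun h => φ h + ∑ a, f (B.gap a) * playProb ε h a := by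
    funext h
    have : φ h = ∑ a, playProb ε h a * φ h := by rw [← Finset.sum_mul, sum_playProb, one_mul]
    rw [this, step, ← Finset.sum_add_distrib]
    refine Finset.sum_congr rfl fun a _ => ?_
    simp only [hφ, List.map_cons, List.sum_cons]
    ring
  have h3 : ∀ T, (B.step ε)^[T] φ []
      = B.total ε T (fun h => ∑ a, f (B.gap a) * playProb ε h a) := by
    intro T
    induction T with
    | zero => simp [total, hφ]
    | succ T ih =>
      rw [Function.iterate_succ_apply, h2, iterate_step_add]
      simp only [ih]
      rw [total, total, Finset.sum_range_succ]
  have h4 : ∀ s : Finset (Fin K), B.total ε T (fun h => ∑ a ∈ s, f (B.gap a) * playProb ε h a)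
      = ∑ a ∈ s, f (B.gap a) * B.total ε T (fun h => playProb ε h a) := by
    intro s
    classical
    induction s using Finset.induction_on with
    | empty => simp [total_const]
    | insert a s ha ih => simp only [Finset.sum_insert ha, total_add, total_const_mul, ih]
  rw [h1, h3, h4]

lemma step_congr (B B' : Bandit K) (ε : ℝ) (h : ∀ a, B.mean a = B'.mean a) :
    B.step ε = B'.step ε := by
  funext φ x
  simp only [step, h]

/-- This is what makes the constant of the bounded-regret claim a function of the means and `ε`
only. -/
lemma total_congr (B B' : Bandit K) (ε : ℝ) (h : ∀ a, B.mean a = B'.mean a) (T : ℕ)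
    (ψ : History K → ℝ) : B.total ε T ψ = B'.total ε T ψ := by
  simp only [total, B.step_congr B' ε h]

end Bandit

/-! ### Potentials -/

section Counts

variable {K : ℕ}

lemma pulls_nil (a : Fin K) : pulls [] a = 0 := rfl

lemma successes_nil (a : Fin K) : successes [] a = 0 := rfl

lemma pulls_cons_self (h : History K) (a : Fin K) (x : Bool) :
    pulls ((a, x) :: h) a = pulls h a + 1 := by
  simp [pulls]

lemma pulls_cons_of_ne (h : History K) {a b : Fin K} (hab : b ≠ a) (x : Bool) :
    pulls ((b, x) :: h) a = pulls h a := by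
  simp [pulls, hab]

lemma successes_cons_true (h : History K) (a : Fin K) :
    successes ((a, true) :: h) a = successes h a + 1 := by
  simp [successes]

lemma successes_cons_false (h : History K) (a : Fin K) :
    successes ((a, false) :: h) a = successes h a := by
  simp [successes]

lemma successes_cons_of_ne (h : History K) {a b : Fin K} (hab : b ≠ a) (x : Bool) :
    successes ((b, x) :: h) a = successes h a := by
  simp [successes, hab]

end Counts

/-- The expected value of `g` after one more Bernoulli trial with success probability `p`,
in terms of the numbers of trials and of successes so far. -/
def trial (p : ℝ) (g : ℕ → ℕ → ℝ) (n s : ℕ) : ℝ := p * g (n + 1) (s + 1) + (1 - p) * g (n + 1) s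

/-- After `j` trials the number of new successes is binomial; the induction is Pascal's rule. -/
lemma iterate_trial (p : ℝ) (g : ℕ → ℕ → ℝ) (j : ℕ) : ∀ n s, (trial p)^[j] g n s
    = ∑ i ∈ Finset.range (j + 1), (j.choose i : ℝ) * p ^ i * (1 - p) ^ (j - i)
        * g (n + j) (s + i) := by
  induction j with
  | zero => intro n s; simp
  | succ j ih =>
    intro n s
    rw [Function.iterate_succ_apply', trial, ih, ih, Finset.sum_range_succ' _ (j + 1)]
    simp only [Nat.choose_succ_succ', Nat.cast_add, add_mul, Finset.sum_add_distrib]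
    refine (congrArg₂ (· + ·) ?_ ?_).trans (add_assoc _ _ _).symm
    · rw [Finset.mul_sum]
      refine Finset.sum_congr rfl fun i _ => ?_
      rw [show n + 1 + j = n + (j + 1) by ring, show s + 1 + i = s + (i + 1) by ring,
        Nat.add_sub_add_right]
      ring
    · rw [Finset.sum_range_succ' _ j, Finset.sum_range_succ _ j]
      simp only [Nat.choose_succ_self, Nat.cast_zero, zero_mul, add_zero]
      rw [mul_add, Finset.mul_sum]
      congr 1
      · refine Finset.sum_congr rfl fun i hi => ?_
        have hi' := Finset.mem_range.1 hi
        rw [show n + 1 + j = n + (j + 1) by ring, show j + 1 - (i + 1) = (j - (i + 1)) + 1 by omega]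
        ring
      · simp only [Nat.choose_zero_right, Nat.sub_zero]
        rw [show n + 1 + j = n + (j + 1) by ring]
        ring

lemma iterate_trial_nonneg {p : ℝ} (h0 : 0 ≤ p) (h1 : p ≤ 1) {g : ℕ → ℕ → ℝ}
    (hg : ∀ n s, 0 ≤ g n s) (j n s : ℕ) : 0 ≤ (trial p)^[j] g n s := by
  rw [iterate_trial]
  have := sub_nonneg.2 h1
  exact Finset.sum_nonneg fun i _ => mul_nonneg (by positivity) (hg _ _)

namespace Bandit

variable {K : ℕ} [NeZero K]

/-- The play probabilities sum to one, so the potential inequality may be checked arm by arm,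
whatever arm the strategy prefers. The cost is charged only to `a`. -/
lemma total_play_le_of_potential (B : Bandit K) (ε : ℝ) (a : Fin K) {c : History K → ℝ}
    (Φ : ℕ → History K → ℝ) (h0 : ∀ h, 0 ≤ Φ 0 h)
    (ha : ∀ t h, c h + (B.mean a * Φ t ((a, true) :: h) + (1 - B.mean a) * Φ t ((a, false) :: h))
      ≤ Φ (t + 1) h)
    (hb : ∀ t h, ∀ b ≠ a,
      B.mean b * Φ t ((b, true) :: h) + (1 - B.mean b) * Φ t ((b, false) :: h) ≤ Φ (t + 1) h)
    (T : ℕ) : B.total ε T (fun h => playProb ε h a * c h) ≤ Φ T [] := by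
  classical
  refine B.total_le_of_potential ε Φ h0 (fun t h => ?_) T
  have h1 : Φ (t + 1) h = ∑ b, playProb ε h b * Φ (t + 1) h := by
    rw [← Finset.sum_mul, sum_playProb, one_mul]
  have h2 : playProb ε h a * c h = ∑ b, playProb ε h b * (if b = a then c h else 0) := by
    simp
  rw [h1, h2, step, ← Finset.sum_add_distrib]
  refine Finset.sum_le_sum fun b _ => ?_
  rw [← mul_add]
  refine mul_le_mul_of_nonneg_left ?_ (playProb_nonneg _ _ _)
  split_ifs with hba
  · subst hba; exact ha t h
  · rw [zero_add]; exact hb t h b hba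

/-- The plays of an arm cost at most what they would cost on an i.i.d. sequence of rewards. -/
lemma total_play_le_sum_trial (B : Bandit K) (ε : ℝ) (a : Fin K) {g : ℕ → ℕ → ℝ}
    (hg : ∀ n s, 0 ≤ g n s) (T : ℕ) :
    B.total ε T (fun h => playProb ε h a * g (pulls h a) (successes h a))
      ≤ ∑ j ∈ Finset.range T, (trial (B.mean a))^[j] g 0 0 := by
  have hnn := fun j n s => iterate_trial_nonneg (B.mean_nonneg a) (B.mean_le_one a) hg j n s
  refine B.total_play_le_of_potential ε a
    (fun t h => ∑ j ∈ Finset.range t, (trial (B.mean a))^[j] g (pulls h a) (successes h a))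
    (fun h => by simp) (fun t h => ?_) (fun t h b hb => ?_) T
  · simp only [pulls_cons_self, successes_cons_true, successes_cons_false]
    rw [Finset.sum_range_succ', Function.iterate_zero_apply, add_comm, Finset.mul_sum,
      Finset.mul_sum, ← Finset.sum_add_distrib]
    simp only [Function.iterate_succ_apply']
    rfl
  · simp only [pulls_cons_of_ne h hb, successes_cons_of_ne h hb]
    rw [← add_mul, add_sub_cancel, one_mul, Finset.sum_range_succ]
    linarith [hnn t (pulls h a) (successes h a)]

/-- The potential is the geometric series `w / (1 - ρ) = w + ρ * w / (1 - ρ)`; plays of other arms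
leave it unchanged. -/
lemma total_play_le_of_contraction (B : Bandit K) (ε : ℝ) (a : Fin K) {c : History K → ℝ}
    {w : ℕ → ℕ → ℝ} {ρ : ℝ} (hρ : ρ < 1) (hw : ∀ n s, 0 ≤ w n s)
    (hAw : ∀ n s, trial (B.mean a) w n s ≤ ρ * w n s)
    (hc : ∀ h, c h ≤ w (pulls h a) (successes h a)) (T : ℕ) :
    B.total ε T (fun h => playProb ε h a * c h) ≤ w 0 0 / (1 - ρ) := by
  have hρ' : 0 < 1 - ρ := sub_pos.2 hρ
  refine B.total_play_le_of_potential ε a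
    (fun _ h => w (pulls h a) (successes h a) / (1 - ρ))
    (fun h => div_nonneg (hw _ _) hρ'.le) (fun t h => ?_) (fun t h b hb => ?_) T
  · simp only [pulls_cons_self, successes_cons_true, successes_cons_false]
    have h1 := hAw (pulls h a) (successes h a)
    rw [trial] at h1
    have h2 := hc h
    have h3 : w (pulls h a) (successes h a) / (1 - ρ) = w (pulls h a) (successes h a)
        + ρ * w (pulls h a) (successes h a) / (1 - ρ) := by field_simp; ring
    have h4 := div_le_div_of_nonneg_right h1 hρ'.le
    rw [h3]
    refine add_le_add h2 (le_trans (le_of_eq ?_) h4)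
    ring
  · simp only [pulls_cons_of_ne h hb, successes_cons_of_ne h hb]
    rw [← add_mul, add_sub_cancel, one_mul]

/-- The potential is the number of plays of `a` still allowed times a supermartingale of `o`. A play
of `a` lowers the first factor by at least the amount needed to pay its cost, and a play of `o` does
not raise the second on average. -/
lemma total_play_le_of_pulls_lt (B : Bandit K) (ε : ℝ) {a o : Fin K} (hao : a ≠ o)
    {c : History K → ℝ} {u : ℕ → ℕ → ℝ} {L : ℝ} (hL : 0 ≤ L) (hu : ∀ n s, 0 ≤ u n s)
    (hAu : ∀ n s, trial (B.mean o) u n s ≤ u n s)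
    (hc : ∀ h, (pulls h a : ℝ) < L → c h ≤ u (pulls h o) (successes h o))
    (hc' : ∀ h, L ≤ (pulls h a : ℝ) → c h ≤ 0) (T : ℕ) :
    B.total ε T (fun h => playProb ε h a * c h) ≤ (L + 1) * u 0 0 := by
  have key := B.total_play_le_of_potential ε a (c := c)
    (fun _ h => max (L + 1 - pulls h a) 0 * u (pulls h o) (successes h o))
    (fun h => mul_nonneg (le_max_right _ _) (hu _ _)) (fun t h => ?_) (fun t h b hb => ?_) T
  · simp only [pulls_nil, successes_nil, Nat.cast_zero, sub_zero] at key
    rwa [max_eq_left (by linarith)] at key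
  · simp only [pulls_cons_self, pulls_cons_of_ne h hao, successes_cons_of_ne h hao]
    rw [← add_mul, add_sub_cancel, one_mul]
    have hu0 := hu (pulls h o) (successes h o)
    push_cast
    rcases lt_or_ge (pulls h a : ℝ) L with h1 | h1
    · have h2 := hc h h1
      rw [max_eq_left (by linarith), max_eq_left (by linarith)]
      nlinarith
    · have h2 := hc' h h1
      rw [max_eq_right (by linarith), zero_mul, add_zero]
      exact h2.trans (mul_nonneg (le_max_right _ _) hu0)
  · rw [pulls_cons_of_ne h hb, pulls_cons_of_ne h hb]
    have hm := le_max_right (L + 1 - pulls h a) 0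
    by_cases hbo : b = o
    · subst hbo
      simp only [pulls_cons_self, successes_cons_true, successes_cons_false]
      have h1 := mul_le_mul_of_nonneg_left (hAu (pulls h b) (successes h b)) hm
      rw [trial] at h1
      linarith
    · rw [pulls_cons_of_ne h hbo, successes_cons_of_ne h hbo, pulls_cons_of_ne h hbo,
        successes_cons_of_ne h hbo, ← add_mul, add_sub_cancel, one_mul]

/-- Here the allowance left to `a` is the tail `q ^ N_a / (1 - q)` of a geometric series, again
times a supermartingale of `o`. -/
lemma total_play_le_of_geometric_pulls (B : Bandit K) (ε : ℝ) {a o : Fin K} (hao : a ≠ o)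
    {c : History K → ℝ} {u : ℕ → ℕ → ℝ} {q : ℝ} (hq0 : 0 ≤ q) (hq1 : q < 1)
    (hu : ∀ n s, 0 ≤ u n s) (hAu : ∀ n s, trial (B.mean o) u n s ≤ u n s)
    (hc : ∀ h, c h ≤ q ^ pulls h a * u (pulls h o) (successes h o)) (T : ℕ) :
    B.total ε T (fun h => playProb ε h a * c h) ≤ u 0 0 / (1 - q) := by
  have hq' : 0 < 1 - q := sub_pos.2 hq1
  have key := B.total_play_le_of_potential ε a (c := c)
    (fun _ h => q ^ pulls h a * u (pulls h o) (successes h o) / (1 - q))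
    (fun h => div_nonneg (mul_nonneg (pow_nonneg hq0 _) (hu _ _)) hq'.le)
    (fun t h => ?_) (fun t h b hb => ?_) T
  · simpa only [pulls_nil, successes_nil, pow_zero, one_mul] using key
  · simp only [pulls_cons_self, pulls_cons_of_ne h hao, successes_cons_of_ne h hao]
    rw [← add_mul, add_sub_cancel, one_mul]
    refine (add_le_add_left (hc h) _).trans (le_of_eq ?_)
    field_simp
    ring
  · rw [pulls_cons_of_ne h hb, pulls_cons_of_ne h hb]
    by_cases hbo : b = o
    · subst hbo
      simp only [pulls_cons_self, successes_cons_true, successes_cons_false]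
      have hm : 0 ≤ q ^ pulls h a / (1 - q) := div_nonneg (pow_nonneg hq0 _) hq'.le
      have h1 := mul_le_mul_of_nonneg_left (hAu (pulls h b) (successes h b)) hm
      rw [trial] at h1
      refine le_trans (le_of_eq ?_) (h1.trans (le_of_eq ?_)) <;> ring
    · rw [pulls_cons_of_ne h hbo, successes_cons_of_ne h hbo, pulls_cons_of_ne h hbo,
        successes_cons_of_ne h hbo, ← add_mul, add_sub_cancel, one_mul]

end Bandit

/-! ### The arm with the largest index -/

section Win

variable {K : ℕ}

lemma mem_argmaxSet {θ : Fin K → ℝ} {a : Fin K} : a ∈ argmaxSet θ ↔ ∀ b, θ b ≤ θ a := by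
  simp [argmaxSet]

lemma measurable_update_prod (a : Fin K) :
    Measurable (fun z : (Fin K → ℝ) × ℝ => Function.update z.1 a z.2) :=
  measurable_update' (X := fun _ => ℝ)

/-- Redrawing one coordinate does not change a product of probability measures. -/
lemma map_update_prod_pi (ν : Fin K → Measure ℝ) [∀ a, IsProbabilityMeasure (ν a)] (a : Fin K) :
    ((Measure.pi ν).prod (ν a)).map (fun z => Function.update z.1 a z.2) = Measure.pi ν := by
  classical
  have hm := measurable_update_prod a
  symm
  refine Measure.pi_eq fun s hs => ?_
  rw [Measure.map_apply hm (MeasurableSet.univ_pi hs)]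
  have h1 : (fun z : (Fin K → ℝ) × ℝ => Function.update z.1 a z.2) ⁻¹' Set.univ.pi s
      = (Set.univ.pi (Function.update s a Set.univ)) ×ˢ s a := by
    ext z
    simp only [Set.mem_preimage, Set.mem_pi, Set.mem_univ, true_imp_iff, Set.mem_prod]
    constructor
    · intro h
      refine ⟨fun b => ?_, by simpa using h a⟩
      by_cases hb : b = a
      · subst hb; simp
      · simpa [hb] using h b
    · rintro ⟨h, ha⟩ b
      by_cases hb : b = a
      · subst hb; simpa using ha
      · simpa [hb] using h b
  rw [h1, Measure.prod_prod, Measure.pi_pi, ← Finset.mul_prod_erase _ _ (Finset.mem_univ a),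
    ← Finset.mul_prod_erase _ (fun i => ν i (s i)) (Finset.mem_univ a), mul_comm]
  simp only [Function.update_self, measure_univ, one_mul]
  congr 1
  refine Finset.prod_congr rfl fun b hb => ?_
  rw [Function.update_of_ne (Finset.ne_of_mem_erase hb)]

lemma pi_eq_lintegral_update (ν : Fin K → Measure ℝ) [∀ a, IsProbabilityMeasure (ν a)]
    (a : Fin K) {s : Set (Fin K → ℝ)} (hs : MeasurableSet s) :
    Measure.pi ν s = ∫⁻ θ, ν a {x | Function.update θ a x ∈ s} ∂(Measure.pi ν) := by
  have hm := measurable_update_prod a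
  conv_lhs => rw [← map_update_prod_pi ν a]
  rw [Measure.map_apply hm hs, Measure.prod_apply (hm hs)]
  rfl

lemma pi_exceed_le (ν : Fin K → Measure ℝ) [∀ a, IsProbabilityMeasure (ν a)]
    {a o : Fin K} (y : ℝ) :
    Measure.pi ν {θ | y < θ a ∧ ∀ b, b ≠ a → b ≠ o → θ b ≤ θ a} ≤ ν a (Set.Ioi y) := by
  have h1 := (measurePreserving_eval ν a).measure_preimage (s := Set.Ioi y)
    measurableSet_Ioi.nullMeasurableSet
  rw [← h1]
  exact measure_mono fun θ hθ => hθ.1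

variable [NeZero K]

/-- The probability that arm `a` is played if the indices are independent with laws `ν`. -/
def winProb (ν : Fin K → Measure ℝ) (a : Fin K) : ℝ≥0∞ := ∫⁻ θ, tieBreak θ a ∂(Measure.pi ν)

lemma tieBreak_of_notMem {θ : Fin K → ℝ} {a : Fin K} (h : a ∉ argmaxSet θ) : tieBreak θ a = 0 := by
  simp [tieBreak, h]

lemma inv_card_le_tieBreak {θ : Fin K → ℝ} {a : Fin K} (h : a ∈ argmaxSet θ) :
    (K : ℝ≥0∞)⁻¹ ≤ tieBreak θ a := by
  rw [tieBreak, PMF.uniformOfFinset_apply_of_mem _ h]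
  gcongr
  exact (Finset.card_le_univ _).trans (by simp)

lemma tieBreak_eq_one {θ : Fin K → ℝ} {a : Fin K} (h : ∀ b ≠ a, θ b < θ a) :
    tieBreak θ a = 1 := by
  have : argmaxSet θ = {a} := by
    ext b
    rw [mem_argmaxSet, Finset.mem_singleton]
    constructor
    · intro hb
      by_contra hne
      exact (h b hne).not_ge (hb a)
    · rintro rfl c
      by_cases hc : c = b
      · rw [hc]
      · exact (h c hc).le
  simp [tieBreak, this]

variable (ν : Fin K → Measure ℝ) [∀ a, IsProbabilityMeasure (ν a)]

lemma mul_prod_le_winProb (o : Fin K) (y : ℝ) :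
    ν o (Set.Ioi y) * ∏ b ∈ Finset.univ.erase o, ν b (Set.Iic y) ≤ winProb ν o := by
  classical
  set s : Fin K → Set ℝ := Function.update (fun _ => Set.Iic y) o (Set.Ioi y) with hs
  have hms : MeasurableSet (Set.univ.pi s) := by
    refine MeasurableSet.univ_pi fun b => ?_
    by_cases hb : b = o
    · subst hb; simp [hs]
    · simp [hs, hb]
  have h1 : Measure.pi ν (Set.univ.pi s)
      = ν o (Set.Ioi y) * ∏ b ∈ Finset.univ.erase o, ν b (Set.Iic y) := by
    rw [Measure.pi_pi, ← Finset.mul_prod_erase _ _ (Finset.mem_univ o)]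
    congr 1
    · simp [hs]
    · refine Finset.prod_congr rfl fun b hb => ?_
      rw [hs, Function.update_of_ne (Finset.ne_of_mem_erase hb)]
  rw [← h1, ← lintegral_indicator_one hms, winProb]
  refine lintegral_mono fun θ => ?_
  by_cases hθ : θ ∈ Set.univ.pi s
  · have ho : y < θ o := by simpa [hs] using hθ o (Set.mem_univ _)
    rw [Set.indicator_of_mem hθ, tieBreak_eq_one]
    · rfl
    · intro b hb
      have := hθ b (Set.mem_univ _)
      simp only [hs, Function.update_of_ne hb, Set.mem_Iic] at this
      exact this.trans_lt ho
  · rw [Set.indicator_of_notMem hθ]; exact zero_le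

/-- If `a` wins with an index at most `y`, all indices are at most `y`. In the other event the
comparison with `o` is dropped, so that the roles of `a` and `o` can be exchanged in
`pi_exceed_mul_le`. -/
lemma winProb_le_add {a o : Fin K} (y : ℝ) :
    winProb ν a ≤ ∏ b, ν b (Set.Iic y)
      + Measure.pi ν {θ | y < θ a ∧ ∀ b, b ≠ a → b ≠ o → θ b ≤ θ a} := by
  classical
  have hm1 : MeasurableSet (Set.univ.pi fun _ : Fin K => Set.Iic y) :=
    MeasurableSet.univ_pi fun _ => measurableSet_Iic
  have hm2 : MeasurableSet {θ : Fin K → ℝ | y < θ a ∧ ∀ b, b ≠ a → b ≠ o → θ b ≤ θ a} := by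
    measurability
  rw [← Measure.pi_pi, ← lintegral_indicator_one hm1, ← lintegral_indicator_one hm2,
    ← lintegral_add_left (measurable_one.indicator hm1), winProb]
  refine lintegral_mono fun θ => ?_
  by_cases ha : a ∈ argmaxSet θ
  · have h1 : tieBreak θ a ≤ 1 := PMF.coe_le_one _ _
    rw [mem_argmaxSet] at ha
    rcases le_or_gt (θ a) y with h | h
    · rw [Set.indicator_of_mem (show θ ∈ Set.univ.pi fun _ : Fin K => Set.Iic y from
        fun b _ => (ha b).trans h)]
      exact h1.trans le_self_add
    · rw [Set.indicator_of_mem (s := {θ : Fin K → ℝ | y < θ a ∧ _})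
        (show θ ∈ {θ : Fin K → ℝ | y < θ a ∧ ∀ b, b ≠ a → b ≠ o → θ b ≤ θ a} from
        ⟨h, fun b _ _ => ha b⟩)]
      exact h1.trans le_add_self
  · rw [tieBreak_of_notMem ha]; exact zero_le

/-- The product over the arms other than `o` is common to both estimates; only the odds of `o`
remain. -/
lemma winProb_mul_le_add {a o : Fin K} (y : ℝ) :
    winProb ν a * ν o (Set.Ioi y) ≤ ν o (Set.Iic y) * winProb ν o
      + Measure.pi ν {θ | y < θ a ∧ ∀ b, b ≠ a → b ≠ o → θ b ≤ θ a} * ν o (Set.Ioi y) := by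
  refine (mul_le_mul_left (winProb_le_add ν (a := a) (o := o) y) _).trans ?_
  rw [add_mul]
  refine add_le_add ?_ le_rfl
  rw [← Finset.mul_prod_erase _ (fun b => ν b (Set.Iic y)) (Finset.mem_univ o), mul_assoc]
  gcongr
  rw [mul_comm]
  exact mul_prod_le_winProb ν o y

/-- If on `(y, ∞)` the law of the index of `a` is dominated by that of `o`, then so is its
chance of being played with an index exceeding `y`. -/
lemma pi_exceed_mul_le {a o : Fin K} (hao : a ≠ o) {y : ℝ} {r : ℝ≥0∞}
    (hr : ∀ s, MeasurableSet s → ν a (s ∩ Set.Ioi y) ≤ r * ν o (s ∩ Set.Ioi y)) :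
    Measure.pi ν {θ | y < θ a ∧ ∀ b, b ≠ a → b ≠ o → θ b ≤ θ a} * ν a (Set.Iic y)
      ≤ r * (K * winProb ν o) := by
  classical
  have hm2 : ∀ a o, MeasurableSet {θ : Fin K → ℝ | y < θ a ∧ ∀ b, b ≠ a → b ≠ o → θ b ≤ θ a} := by
    intro a o; measurability
  set E : Set (Fin K → ℝ) := {θ | y < θ o ∧ ∀ b, b ≠ o → b ≠ a → θ b ≤ θ o} with hE
  have hup : ∀ (θ : Fin K → ℝ) (a o : Fin K), {x | Function.update θ a x ∈
      {θ : Fin K → ℝ | y < θ a ∧ ∀ b, b ≠ a → b ≠ o → θ b ≤ θ a}}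
      = {x | ∀ b, b ≠ a → b ≠ o → θ b ≤ x} ∩ Set.Ioi y := by
    intro θ a o
    ext x
    simp only [Set.mem_ofPred_eq, Function.update_self, Set.mem_inter_iff, Set.mem_Ioi]
    constructor
    · rintro ⟨h1, h2⟩
      exact ⟨fun b hb hb' => by simpa [hb] using h2 b hb hb', h1⟩
    · rintro ⟨h1, h2⟩
      exact ⟨h2, fun b hb hb' => by simpa [hb] using h1 b hb hb'⟩
  -- With all other coordinates fixed, both events ask that one index exceed `y` and the same
  -- competitors, so domination of the two laws integrates.
  have h1 : Measure.pi ν {θ | y < θ a ∧ ∀ b, b ≠ a → b ≠ o → θ b ≤ θ a}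
      ≤ r * Measure.pi ν E := by
    rw [pi_eq_lintegral_update ν a (hm2 a o), pi_eq_lintegral_update ν o (hm2 o a),
      ← lintegral_const_mul]
    · refine lintegral_mono fun θ => ?_
      simp only [hup]
      have hs : {x | ∀ b, b ≠ o → b ≠ a → θ b ≤ x} = {x | ∀ b, b ≠ a → b ≠ o → θ b ≤ x} := by
        ext x; exact ⟨fun h b h1 h2 => h b h2 h1, fun h b h1 h2 => h b h2 h1⟩
      rw [hs]
      exact hr _ (by measurability)
    · exact measurable_measure_prodMk_left (measurable_update_prod o (hm2 o a))
  have h2 : Measure.pi ν E * ν a (Set.Iic y) = Measure.pi ν (E ∩ {θ | θ a ≤ y}) := by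
    have hm3 : MeasurableSet (E ∩ {θ | θ a ≤ y}) :=
      (hm2 o a).inter (measurableSet_le (measurable_pi_apply a) measurable_const)
    rw [pi_eq_lintegral_update ν a hm3, ← lintegral_indicator_one (hm2 o a),
      ← lintegral_mul_const _ (measurable_one.indicator (hm2 o a))]
    refine lintegral_congr fun θ => ?_
    have hiff : ∀ x, Function.update θ a x ∈ E ↔ θ ∈ E := by
      intro x
      simp only [hE, Set.mem_ofPred_eq, Function.update_of_ne hao.symm]
      refine and_congr_right fun _ => forall_congr' fun b => ?_
      by_cases hb : b = a
      · simp [hb]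
      · simp [hb]
    by_cases hθ : θ ∈ E
    · rw [Set.indicator_of_mem hθ, Pi.one_apply, one_mul]
      congr 1
      ext x
      simp [hiff, hθ]
    · rw [Set.indicator_of_notMem hθ, zero_mul]
      simp [hiff, hθ]
  -- On this event `o` is a maximizer, but possibly a tied one; the factor `K` pays for the
  -- tie-breaking.
  have h3 : Measure.pi ν (E ∩ {θ | θ a ≤ y}) ≤ K * winProb ν o := by
    have hm3 : MeasurableSet (E ∩ {θ | θ a ≤ y}) :=
      (hm2 o a).inter (measurableSet_le (measurable_pi_apply a) measurable_const)
    have hK : (K : ℝ≥0∞) ≠ 0 := by exact_mod_cast NeZero.ne K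
    rw [← lintegral_indicator_one hm3, winProb, ← lintegral_const_mul _ (measurable_tieBreak o)]
    refine lintegral_mono fun θ => ?_
    by_cases hθ : θ ∈ E ∩ {θ | θ a ≤ y}
    · rw [Set.indicator_of_mem hθ, Pi.one_apply]
      have : o ∈ argmaxSet θ := by
        rw [mem_argmaxSet]
        intro b
        by_cases hbo : b = o
        · rw [hbo]
        · by_cases hba : b = a
          · subst hba; exact le_trans hθ.2 hθ.1.1.le
          · exact hθ.1.2 b hbo hba
      calc (1 : ℝ≥0∞) = K * (K : ℝ≥0∞)⁻¹ := (ENNReal.mul_inv_cancel hK (by simp)).symm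
        _ ≤ _ := by gcongr; exact inv_card_le_tieBreak this
    · rw [Set.indicator_of_notMem hθ]; exact zero_le
  calc _ ≤ r * Measure.pi ν E * ν a (Set.Iic y) := by gcongr
    _ = r * (Measure.pi ν E * ν a (Set.Iic y)) := mul_assoc _ _ _
    _ ≤ _ := by rw [h2]; gcongr

end Win

/-! ### Playing a bad arm, charged to plays of the optimal arm -/

section PlayProb

variable {K : ℕ} [NeZero K]

lemma playProb_eq (ε : ℝ) (h : History K) (a : Fin K) :
    playProb ε h a = (winProb (posterior ε h) a).toReal := rfl

lemma winProb_posterior_ne_top (ε : ℝ) (h : History K) (a : Fin K) :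
    winProb (posterior ε h) a ≠ ∞ := PMF.apply_ne_top (playLaw ε h) a

/-- The odds that the index of arm `o` is at most `y`. -/
def lowOdds (ε y : ℝ) (h : History K) (o : Fin K) : ℝ :=
  (1 - (posterior ε h o).real (Set.Ioi y)) / (posterior ε h o).real (Set.Ioi y)

lemma playProb_le_aux (ε : ℝ) {y : ℝ} (h : History K) {a o : Fin K}
    (hp : 0 < (posterior ε h o).real (Set.Ioi y)) :
    playProb ε h a ≤ lowOdds ε y h o * playProb ε h o + (Measure.pi (posterior ε h)).real
      {θ | y < θ a ∧ ∀ b, b ≠ a → b ≠ o → θ b ≤ θ a} := by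
  have h1 := winProb_mul_le_add (posterior ε h) (a := a) (o := o) y
  have hfin := winProb_posterior_ne_top ε h o
  have h2 := ENNReal.toReal_mono (ENNReal.add_ne_top.2
    ⟨ENNReal.mul_ne_top (measure_ne_top _ _) hfin,
      ENNReal.mul_ne_top (measure_ne_top _ _) (measure_ne_top _ _)⟩) h1
  rw [ENNReal.toReal_add (ENNReal.mul_ne_top (measure_ne_top _ _) hfin)
    (ENNReal.mul_ne_top (measure_ne_top _ _) (measure_ne_top _ _)), ENNReal.toReal_mul,
    ENNReal.toReal_mul, ENNReal.toReal_mul, ← playProb_eq, ← playProb_eq] at h2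
  have h3 : (posterior ε h o (Set.Iic y)).toReal = 1 - (posterior ε h o).real (Set.Ioi y) := by
    rw [← probReal_compl_eq_one_sub measurableSet_Ioi, Set.compl_Ioi]; rfl
  rw [h3] at h2
  change _ * (posterior ε h o).real _ ≤ _ + _ * (posterior ε h o).real _ at h2
  rw [lowOdds, div_mul_eq_mul_div, ← sub_le_iff_le_add, le_div_iff₀ hp, sub_mul]
  exact sub_le_iff_le_add.2 h2

lemma playProb_le_add_tail (ε : ℝ) {y : ℝ} (h : History K) {a o : Fin K}
    (hp : 0 < (posterior ε h o).real (Set.Ioi y)) :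
    playProb ε h a ≤ lowOdds ε y h o * playProb ε h o
      + (posterior ε h a).real (Set.Ioi y) := by
  refine (playProb_le_aux ε h hp).trans ?_
  gcongr
  exact ENNReal.toReal_mono (measure_ne_top _ _) (pi_exceed_le _ y)

/-- Every term is a multiple of the chance of playing `o`, so the plays of `a` can be summed over
plays of `o`. The factor 2 comes from dividing by the mass of `a` below `y`. -/
lemma playProb_le_of_dominated (ε : ℝ) {y r : ℝ} (hr0 : 0 ≤ r) (h : History K) {a o : Fin K}
    (hao : a ≠ o) (hp : 0 < (posterior ε h o).real (Set.Ioi y))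
    (hq : 1 / 2 ≤ (posterior ε h a).real (Set.Iic y))
    (hr : ∀ s, MeasurableSet s → posterior ε h a (s ∩ Set.Ioi y)
      ≤ ENNReal.ofReal r * posterior ε h o (s ∩ Set.Ioi y)) :
    playProb ε h a ≤ lowOdds ε y h o * playProb ε h o + 2 * r * K * playProb ε h o := by
  refine (playProb_le_aux ε h hp).trans ?_
  gcongr
  have h1 := pi_exceed_mul_le (posterior ε h) hao hr
  have hfin := winProb_posterior_ne_top ε h o
  have h2 := ENNReal.toReal_mono (ENNReal.mul_ne_top ENNReal.ofReal_ne_top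
    (ENNReal.mul_ne_top (by simp) hfin)) h1
  rw [ENNReal.toReal_mul, ENNReal.toReal_mul, ENNReal.toReal_mul, ENNReal.toReal_ofReal hr0,
    ← playProb_eq, ENNReal.toReal_natCast] at h2
  change _ * (posterior ε h a).real _ ≤ _ at h2
  have h3 : (Measure.pi (posterior ε h)).real
      {θ | y < θ a ∧ ∀ b, b ≠ a → b ≠ o → θ b ≤ θ a} * (1 / 2)
      ≤ (Measure.pi (posterior ε h)).real
      {θ | y < θ a ∧ ∀ b, b ≠ a → b ≠ o → θ b ≤ θ a} * (posterior ε h a).real (Set.Iic y) :=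
    mul_le_mul_of_nonneg_left hq measureReal_nonneg
  have h4 := h3.trans h2
  linarith

end PlayProb

/-! ### Binomial and Beta tails -/

/-- The probability of at most `k` successes in `N` trials with success probability `y`. -/
def binCDF (N k : ℕ) (y : ℝ) : ℝ :=
  ∑ i ∈ Finset.range (k + 1), (N.choose i : ℝ) * y ^ i * (1 - y) ^ (N - i)

lemma binCDF_eq_eval (N k : ℕ) (y : ℝ) :
    binCDF N k y = (∑ i ∈ Finset.range (k + 1), bernsteinPolynomial ℝ N i).eval y := by
  simp [binCDF, bernsteinPolynomial, Polynomial.eval_finsetSum]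

/-- The derivatives of consecutive Bernstein polynomials telescope. -/
lemma derivative_sum_bernstein (n k : ℕ) :
    Polynomial.derivative (∑ i ∈ Finset.range (k + 1), bernsteinPolynomial ℝ (n + 1) i)
      = -((n + 1 : ℕ) * bernsteinPolynomial ℝ n k) := by
  induction k with
  | zero =>
    simp [bernsteinPolynomial.derivative_zero]
    ring
  | succ k ih =>
    rw [Finset.sum_range_succ, Polynomial.derivative_add, ih, bernsteinPolynomial.derivative_succ,
      Nat.add_sub_cancel]
    ring

lemma hasDerivAt_binCDF (n k : ℕ) (y : ℝ) :
    HasDerivAt (binCDF (n + 1) k) (-((n + 1) * n.choose k * y ^ k * (1 - y) ^ (n - k))) y := by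
  have h := (∑ i ∈ Finset.range (k + 1), bernsteinPolynomial ℝ (n + 1) i).hasDerivAt y
  rw [derivative_sum_bernstein] at h
  have h1 : binCDF (n + 1) k
      = fun y => (∑ i ∈ Finset.range (k + 1), bernsteinPolynomial ℝ (n + 1) i).eval y :=
    funext fun y => binCDF_eq_eval _ _ _
  rw [h1]
  refine h.congr_deriv ?_
  rw [Polynomial.eval_neg, Polynomial.eval_mul, Polynomial.eval_natCast, bernsteinPolynomial]
  simp only [Polynomial.eval_mul, Polynomial.eval_natCast, Polynomial.eval_pow, Polynomial.eval_X,
    Polynomial.eval_sub, Polynomial.eval_one]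
  push_cast
  ring

lemma binCDF_one {n k : ℕ} (hk : k ≤ n) : binCDF (n + 1) k 1 = 0 := by
  refine Finset.sum_eq_zero fun i hi => ?_
  have := Finset.mem_range.1 hi
  rw [sub_self, zero_pow (by omega), mul_zero]

lemma betaPDF_nat {n k : ℕ} (hk : k ≤ n) {x : ℝ} (h0 : 0 < x) (h1 : x < 1) :
    betaPDF ((k : ℝ) + 1) ((n : ℝ) + 2 - (k + 1)) x
      = ENNReal.ofReal ((n + 1) * n.choose k * x ^ k * (1 - x) ^ (n - k)) := by
  rw [betaPDF_of_pos_lt_one h0 h1]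
  congr 1
  have e1 : (n : ℝ) + 2 - (k + 1) = ((n - k : ℕ) : ℝ) + 1 := by
    rw [Nat.cast_sub hk]; ring
  have e2 : beta ((k : ℝ) + 1) (((n - k : ℕ) : ℝ) + 1)
      = (k.factorial * (n - k).factorial : ℝ) / (n + 1).factorial := by
    rw [beta, Real.Gamma_nat_eq_factorial, Real.Gamma_nat_eq_factorial]
    congr 1
    rw [← Real.Gamma_nat_eq_factorial]
    congr 1
    rw [Nat.cast_sub hk]; push_cast; ring
  rw [e1, e2, add_sub_cancel_right, add_sub_cancel_right, Real.rpow_natCast, Real.rpow_natCast]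
  have e3 : (n.choose k : ℝ) * (k.factorial * (n - k).factorial) = n.factorial := by
    rw [← mul_assoc]; exact_mod_cast Nat.choose_mul_factorial_mul_factorial hk
  have hne : (k.factorial * (n - k).factorial : ℝ) ≠ 0 := by positivity
  rw [one_div_div, Nat.factorial_succ]
  push_cast
  rw [← e3]
  field_simp

/-- Beta–binomial duality: minus the Beta density is the derivative of the binomial distribution
function in its success probability, which vanishes at 1. -/
lemma betaMeasure_Ioi {n k : ℕ} (hk : k ≤ n) {y : ℝ} (h0 : 0 ≤ y) (h1 : y ≤ 1) :
    betaMeasure ((k : ℝ) + 1) ((n : ℝ) + 2 - (k + 1)) (Set.Ioi y)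
      = ENNReal.ofReal (binCDF (n + 1) k y) := by
  set p : ℝ → ℝ := fun x => (n + 1) * n.choose k * x ^ k * (1 - x) ^ (n - k) with hp
  have hcont : Continuous p := by fun_prop
  have hind : ∀ x, (Set.Ioi y).indicator (betaPDF ((k : ℝ) + 1) ((n : ℝ) + 2 - (k + 1))) x
      = (Set.Ioo y 1).indicator (fun x => ENNReal.ofReal (p x)) x := by
    intro x
    by_cases hx : x ∈ Set.Ioi y
    · rw [Set.indicator_of_mem hx]
      rcases lt_or_ge x 1 with hx1 | hx1
      · rw [Set.indicator_of_mem (show x ∈ Set.Ioo y 1 from ⟨hx, hx1⟩),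
          betaPDF_nat hk (h0.trans_lt (Set.mem_Ioi.1 hx)) hx1]
      · rw [Set.indicator_of_notMem (fun h => hx1.not_gt h.2), betaPDF_eq_zero_of_one_le hx1]
    · rw [Set.indicator_of_notMem hx, Set.indicator_of_notMem (fun h => hx h.1)]
  rw [betaMeasure, withDensity_apply _ measurableSet_Ioi, ← lintegral_indicator measurableSet_Ioi,
    lintegral_congr hind, lintegral_indicator measurableSet_Ioo,
    ← ofReal_integral_eq_lintegral_ofReal]
  · congr 1
    rw [← integral_Ioc_eq_integral_Ioo, ← intervalIntegral.integral_of_le h1]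
    have hd := intervalIntegral.integral_eq_sub_of_hasDerivAt (a := y) (b := 1)
      (fun x _ => hasDerivAt_binCDF n k x)
      ((Continuous.neg hcont).intervalIntegrable _ _)
    rw [binCDF_one hk, intervalIntegral.integral_neg] at hd
    linarith
  · exact (hcont.integrableOn_Icc (a := y) (b := 1)).mono_set Set.Ioo_subset_Icc_self
  · refine (ae_restrict_iff' measurableSet_Ioo).2 (ae_of_all _ fun x hx => ?_)
    have hx0 : 0 ≤ x := h0.trans hx.1.le
    have hx1 : 0 ≤ 1 - x := sub_nonneg.2 hx.2.le
    simp only [hp, Pi.zero_apply]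
    positivity

lemma binCDF_nonneg (N k : ℕ) {y : ℝ} (h0 : 0 ≤ y) (h1 : y ≤ 1) : 0 ≤ binCDF N k y := by
  have := sub_nonneg.2 h1
  exact Finset.sum_nonneg fun i _ => by positivity

lemma term_le_binCDF (N : ℕ) {i k : ℕ} (hi : i ≤ k) {y : ℝ} (h0 : 0 ≤ y) (h1 : y ≤ 1) :
    (N.choose i : ℝ) * y ^ i * (1 - y) ^ (N - i) ≤ binCDF N k y := by
  have := sub_nonneg.2 h1
  exact Finset.single_le_sum
    (f := fun i => (N.choose i : ℝ) * y ^ i * (1 - y) ^ (N - i)) (fun i _ => by positivity)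
    (Finset.mem_range.2 (by omega))

lemma pow_le_binCDF (N k : ℕ) {y : ℝ} (h0 : 0 ≤ y) (h1 : y ≤ 1) :
    (1 - y) ^ N ≤ binCDF N k y := by
  simpa using term_le_binCDF N (Nat.zero_le k) h0 h1

lemma sum_binomial (N : ℕ) (x y : ℝ) :
    ∑ i ∈ Finset.range (N + 1), (N.choose i : ℝ) * x ^ i * y ^ (N - i) = (x + y) ^ N := by
  rw [add_pow]
  exact Finset.sum_congr rfl fun i _ => by ring

/-- Chernoff's bound for the lower tail, with the tilt `l ≤ 1` left free. -/
lemma binCDF_mul_pow_le {N k : ℕ} (hk : k ≤ N) {y l : ℝ} (h0 : 0 ≤ y) (h1 : y ≤ 1) (hl0 : 0 ≤ l)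
    (hl1 : l ≤ 1) : binCDF N k y * l ^ k ≤ (1 - y + y * l) ^ N := by
  have h1' := sub_nonneg.2 h1
  calc binCDF N k y * l ^ k
      ≤ ∑ i ∈ Finset.range (k + 1), (N.choose i : ℝ) * (y * l) ^ i * (1 - y) ^ (N - i) := by
        rw [binCDF, Finset.sum_mul]
        refine Finset.sum_le_sum fun i hi => ?_
        have hi' : i ≤ k := Nat.lt_succ_iff.1 (Finset.mem_range.1 hi)
        have := mul_le_mul_of_nonneg_left (pow_le_pow_of_le_one hl0 hl1 hi')
          (show 0 ≤ (N.choose i : ℝ) * y ^ i * (1 - y) ^ (N - i) by positivity)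
        rw [mul_pow]
        linarith
    _ ≤ ∑ i ∈ Finset.range (N + 1), (N.choose i : ℝ) * (y * l) ^ i * (1 - y) ^ (N - i) :=
        Finset.sum_le_sum_of_subset_of_nonneg
          (Finset.range_subset_range.2 (by omega)) (fun i _ _ => by positivity)
    _ = _ := by rw [sum_binomial, add_comm]

lemma one_sub_binCDF_mul_pow_le {N k : ℕ} (hk : k ≤ N) {y l : ℝ} (h0 : 0 ≤ y) (h1 : y ≤ 1)
    (hl : 1 ≤ l) : (1 - binCDF N k y) * l ^ (k + 1) ≤ (1 - y + y * l) ^ N := by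
  have h1' := sub_nonneg.2 h1
  have hsum := sum_binomial N y (1 - y)
  rw [add_sub_cancel, one_pow, ← Finset.sum_range_add_sum_Ico _ (show k + 1 ≤ N + 1 by omega)]
    at hsum
  have hs : 1 - binCDF N k y
      = ∑ i ∈ Finset.Ico (k + 1) (N + 1), (N.choose i : ℝ) * y ^ i * (1 - y) ^ (N - i) := by
    rw [binCDF]; linarith
  have hl0 : 0 ≤ l := zero_le_one.trans hl
  calc (1 - binCDF N k y) * l ^ (k + 1)
      ≤ ∑ i ∈ Finset.Ico (k + 1) (N + 1), (N.choose i : ℝ) * (y * l) ^ i * (1 - y) ^ (N - i) := by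
        rw [hs, Finset.sum_mul]
        refine Finset.sum_le_sum fun i hi => ?_
        have := mul_le_mul_of_nonneg_left (pow_le_pow_right₀ hl (Finset.mem_Ico.1 hi).1)
          (show 0 ≤ (N.choose i : ℝ) * y ^ i * (1 - y) ^ (N - i) by positivity)
        rw [mul_pow]
        linarith
    _ ≤ ∑ i ∈ Finset.range (N + 1), (N.choose i : ℝ) * (y * l) ^ i * (1 - y) ^ (N - i) :=
        Finset.sum_le_sum_of_subset_of_nonneg
          (fun i hi => Finset.mem_range.2 (Finset.mem_Ico.1 hi).2) (fun i _ _ => by positivity)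
    _ = _ := by rw [sum_binomial, add_comm]

lemma binCDF_pos (N k : ℕ) {y : ℝ} (h0 : 0 ≤ y) (h1 : y < 1) : 0 < binCDF N k y :=
  (pow_pos (sub_pos.2 h1) N).trans_le (pow_le_binCDF N k h0 h1.le)

/-! ### Exponential rates -/

/-- The real-valued formula for the Bernoulli relative entropy. -/
def klReal (p q : ℝ) : ℝ := p * Real.log (p / q) + (1 - p) * Real.log ((1 - p) / (1 - q))

/-- With λ = (t - y)/2, use exp λ ≤ 1 + λ + λ² and (t - y)λ = 2λ². The rate is not sharp, but it
serves for either sign of `t - y`. -/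
lemma bernoulli_mgf_le {y t : ℝ} (hy0 : 0 ≤ y) (hy1 : y ≤ 1) (ht0 : 0 ≤ t) (ht1 : t ≤ 1) :
    1 - y + y * Real.exp ((t - y) / 2)
      ≤ Real.exp (t * ((t - y) / 2)) * Real.exp (-(t - y) ^ 2 / 4) := by
  have habs : |(t - y) / 2| ≤ 1 := by rw [abs_le]; constructor <;> linarith
  have h1 := (abs_le.1 (Real.abs_exp_sub_one_sub_id_le habs)).2
  rw [← Real.exp_add]
  have h2 := Real.add_one_le_exp (t * ((t - y) / 2) + -(t - y) ^ 2 / 4)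
  have h3 := mul_le_mul_of_nonneg_left h1 hy0
  nlinarith [sq_nonneg (t - y), mul_nonneg (sub_nonneg.2 hy1) (sq_nonneg (t - y))]

/-- The exponential weight of `s` successes in `n` trials, relative to the threshold `t`. -/
def tilt (p t : ℝ) (n s : ℕ) : ℝ := Real.exp ((t - p) / 2 * (s - t * n))

lemma tilt_pos (p t : ℝ) (n s : ℕ) : 0 < tilt p t n s := Real.exp_pos _

lemma tilt_zero (p t : ℝ) : tilt p t 0 0 = 1 := by simp [tilt]

/-- The rate at which the exponential weights decrease on average. -/
def rate (p t : ℝ) : ℝ := Real.exp (-(t - p) ^ 2 / 4)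

lemma rate_pos (p t : ℝ) : 0 < rate p t := Real.exp_pos _

lemma rate_lt_one {p t : ℝ} (h : p ≠ t) : rate p t < 1 := by
  rw [rate, Real.exp_lt_one_iff]
  have := sq_pos_of_ne_zero (sub_ne_zero.2 h.symm)
  linarith

/-- The exponential weight is a supermartingale contracting by `rate`; it is at least 1 on
deviations beyond `t`, to either side of `p`. -/
lemma trial_tilt_le {p t : ℝ} (hp0 : 0 ≤ p) (hp1 : p ≤ 1) (ht0 : 0 ≤ t) (ht1 : t ≤ 1) (n s : ℕ) :
    trial p (tilt p t) n s ≤ rate p t * tilt p t n s := by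
  have h1 := mul_le_mul_of_nonneg_left (bernoulli_mgf_le hp0 hp1 ht0 ht1)
    (Real.exp_pos ((t - p) / 2 * (s - t * n) - t * ((t - p) / 2))).le
  have e1 : trial p (tilt p t) n s = Real.exp ((t - p) / 2 * (s - t * n) - t * ((t - p) / 2))
      * (1 - p + p * Real.exp ((t - p) / 2)) := by
    have a1 : (t - p) / 2 * (((s + 1 : ℕ) : ℝ) - t * ((n + 1 : ℕ) : ℝ))
        = ((t - p) / 2 * (s - t * n) - t * ((t - p) / 2)) + (t - p) / 2 := by push_cast; ring
    have a2 : (t - p) / 2 * ((s : ℝ) - t * ((n + 1 : ℕ) : ℝ))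
        = ((t - p) / 2 * (s - t * n) - t * ((t - p) / 2)) := by push_cast; ring
    rw [trial, tilt, tilt, a1, a2, Real.exp_add]
    ring
  rw [e1]
  refine h1.trans (le_of_eq ?_)
  rw [← mul_assoc, ← Real.exp_add, sub_add_cancel, mul_comm, rate, tilt]

lemma one_le_tilt_of_le {p t : ℝ} (h : t ≤ p) {n s : ℕ} (hs : (s : ℝ) ≤ t * n) :
    1 ≤ tilt p t n s := by
  rw [tilt, Real.one_le_exp_iff]
  nlinarith

lemma one_le_tilt_of_ge {p t : ℝ} (h : p ≤ t) {n s : ℕ} (hs : t * n ≤ (s : ℝ)) :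
    1 ≤ tilt p t n s := by
  rw [tilt, Real.one_le_exp_iff]
  nlinarith

lemma one_sub_binCDF_le {n k : ℕ} (hk : k ≤ n) {y t : ℝ} (h0 : 0 ≤ y) (hyt : y ≤ t) (ht : t ≤ 1)
    (hkt : t * n ≤ k + 1) : 1 - binCDF (n + 1) k y ≤ 3 * rate y t ^ n := by
  have hx : 0 ≤ (t - y) / 2 := by linarith
  have hy1 : y ≤ 1 := hyt.trans ht
  have ht0 : 0 ≤ t := h0.trans hyt
  have h1 := one_sub_binCDF_mul_pow_le (N := n + 1) (k := k) (by omega) h0 hy1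
    (Real.one_le_exp hx)
  have h2 : (1 - y + y * Real.exp ((t - y) / 2)) ^ (n + 1)
      ≤ (Real.exp (t * ((t - y) / 2)) * rate y t) ^ (n + 1) :=
    pow_le_pow_left₀ (add_nonneg (sub_nonneg.2 hy1) (mul_nonneg h0 (Real.exp_pos _).le))
      (bernoulli_mgf_le h0 hy1 ht0 ht) _
  have h3 := h1.trans h2
  have h4 : (1 - binCDF (n + 1) k y) ≤ (Real.exp (t * ((t - y) / 2)) * rate y t) ^ (n + 1)
      * Real.exp (-((t - y) / 2 * (k + 1))) := by
    rw [Real.exp_neg, ← div_eq_mul_inv, le_div_iff₀ (Real.exp_pos _)]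
    refine le_trans (le_of_eq ?_) h3
    rw [← Real.exp_nat_mul]
    push_cast
    ring_nf
  refine h4.trans ?_
  -- The sum has `n + 1` trials but the threshold refers to `n`; the excess exponent is at most `t *
  -- (t - y) / 2 ≤ 1`, which leaves a factor `e < 3`.
  have h5 : (Real.exp (t * ((t - y) / 2))) ^ (n + 1) * Real.exp (-((t - y) / 2 * (k + 1))) ≤ 3 := by
    rw [← Real.exp_nat_mul, ← Real.exp_add]
    refine le_trans (Real.exp_le_exp.2 ?_) Real.exp_one_lt_three.le
    push_cast
    nlinarith
  have h6 : rate y t ^ (n + 1) ≤ rate y t ^ n := by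
    rw [pow_succ]
    refine mul_le_of_le_one_right (pow_pos (rate_pos _ _) _).le ?_
    rw [rate, Real.exp_le_one_iff]
    have := sq_nonneg (t - y)
    linarith
  rw [mul_pow, mul_right_comm]
  exact mul_le_mul h5 h6 (pow_pos (rate_pos _ _) _).le (by norm_num)

lemma binCDF_le_exp {n k : ℕ} (hk : k ≤ n) {z y : ℝ} (hz : 0 < z) (hzy : z < y) (hy : y < 1)
    (hkz : (k : ℝ) ≤ z * n) : binCDF (n + 1) k y ≤ Real.exp (-(n * klReal z y)) := by
  have hy0 : 0 < y := hz.trans hzy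
  have hz1 : 0 < 1 - z := by linarith
  have hy1 : 0 < 1 - y := by linarith
  -- The optimal Chernoff tilt. The relative entropy must come out exactly here, since this exponent
  -- fixes the constant of the logarithmic bound.
  set l : ℝ := z * (1 - y) / (y * (1 - z)) with hl
  have hl0 : 0 < l := by positivity
  have hl1 : l ≤ 1 := by
    rw [hl, div_le_one (by positivity)]; nlinarith
  have h1 := binCDF_mul_pow_le (N := n + 1) (k := k) (by omega) hy0.le hy.le hl0.le hl1
  have e1 : 1 - y + y * l = (1 - y) / (1 - z) := by
    rw [hl]; field_simp; ring
  rw [e1] at h1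
  have h2 : ((1 - y) / (1 - z)) ^ (n + 1) ≤ ((1 - y) / (1 - z)) ^ n := by
    refine pow_le_pow_of_le_one (by positivity) ?_ (by omega)
    rw [div_le_one hz1]; linarith
  have h3 : Real.exp (z * n * Real.log l) ≤ l ^ k := by
    rw [← Real.rpow_natCast, Real.rpow_def_of_pos hl0, Real.exp_le_exp, mul_comm (Real.log l)]
    exact mul_le_mul_of_nonpos_right hkz (Real.log_nonpos hl0.le hl1)
  have h4 : binCDF (n + 1) k y * Real.exp (z * n * Real.log l) ≤ ((1 - y) / (1 - z)) ^ n :=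
    (mul_le_mul_of_nonneg_left h3 (binCDF_nonneg _ _ hy0.le hy.le)).trans (h1.trans h2)
  rw [← le_div_iff₀ (Real.exp_pos _)] at h4
  refine h4.trans (le_of_eq ?_)
  rw [← Real.exp_log (show 0 < (1 - y) / (1 - z) by positivity), ← Real.exp_nat_mul,
    ← Real.exp_sub]
  congr 1
  rw [klReal, hl, Real.log_div (by positivity) (by positivity),
    Real.log_div (by positivity) (by positivity), Real.log_div (by positivity) (by positivity),
    Real.log_div (by positivity) (by positivity), Real.log_mul (by positivity) (by positivity),
    Real.log_mul (by positivity) (by positivity)]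
  ring

lemma klReal_pos {p q : ℝ} (hp0 : 0 < p) (hp1 : p < 1) (hq0 : 0 < q) (hq1 : q < 1) (hpq : p ≠ q) :
    0 < klReal p q := by
  have hp1' : 0 < 1 - p := sub_pos.2 hp1
  have hq1' : 0 < 1 - q := sub_pos.2 hq1
  have h1 := Real.log_lt_sub_one_of_pos (div_pos hq0 hp0)
    (fun h => hpq ((div_eq_one_iff_eq hp0.ne').1 h).symm)
  have h2 := Real.log_le_sub_one_of_pos (div_pos hq1' hp1')
  have e1 : Real.log (p / q) = -Real.log (q / p) := by rw [← Real.log_inv, inv_div]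
  have e2 : Real.log ((1 - p) / (1 - q)) = -Real.log ((1 - q) / (1 - p)) := by
    rw [← Real.log_inv, inv_div]
  have h3 := mul_lt_mul_of_pos_left h1 hp0
  have h4 := mul_le_mul_of_nonneg_left h2 hp1'.le
  have e3 : p * (q / p - 1) = q - p := by field_simp
  have e4 : (1 - p) * ((1 - q) / (1 - p) - 1) = p - q := by field_simp; ring
  rw [klReal, e1, e2]
  linarith

/-- The likelihood ratio of `s` successes in `n` trials decays geometrically for
`s / n` up to some point beyond `y`. -/
lemma exists_likelihood_ratio_le {y m : ℝ} (hy0 : 0 < y) (hym : y < m) (hm : m ≤ 1) :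
    ∃ t ρ : ℝ, y < t ∧ t < m ∧ 0 ≤ ρ ∧ ρ < 1 ∧ ∀ n s : ℕ, s ≤ n → (s : ℝ) ≤ t * n →
      (m / y) ^ s * ((1 - m) / (1 - y)) ^ (n - s) ≤ ρ ^ n := by
  rcases hm.eq_or_lt with rfl | hm1
  -- For `m = 1` the base of the second power is zero, and `s < n` makes its exponent positive
  -- unless `n = 0`.
  · refine ⟨(y + 1) / 2, 1 / 2, by linarith, by linarith, by norm_num, by norm_num, ?_⟩
    intro n s hsn hs
    rcases Nat.eq_zero_or_pos n with rfl | hn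
    · obtain rfl : s = 0 := by omega
      simp
    · have hn' : (0 : ℝ) < n := by exact_mod_cast hn
      have : (s : ℝ) < n := by nlinarith
      have : s < n := by exact_mod_cast this
      rw [sub_self, zero_div, zero_pow (by omega), mul_zero]
      positivity
  · have hkl := klReal_pos hy0 (hym.trans hm1) (hy0.trans hym) hm1 hym.ne
    set v := m / y with hv
    set u := (1 - m) / (1 - y) with hu
    have hv1 : 1 < v := (one_lt_div hy0).2 hym
    have hu0 : 0 < u := div_pos (by linarith) (by linarith)
    have hu1 : u < 1 := (div_lt_one (by linarith)).2 (by linarith)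
    set D := Real.log v - Real.log u with hD
    have hD0 : 0 < D := by
      have := Real.log_pos hv1
      have := Real.log_neg hu0 hu1
      linarith
    have hκ : klReal y m = -(y * Real.log v + (1 - y) * Real.log u) := by
      rw [klReal, hv, hu, ← inv_div m y, ← inv_div (1 - m) (1 - y), Real.log_inv, Real.log_inv]
      ring
    set k := klReal y m
    -- At `s = y * n` the log-likelihood ratio is `-k * n`, and it has slope `D` in `s`; moving up
    -- to `(y + δ) * n` uses at most half of the exponent.
    set δ := min ((m - y) / 2) (k / 2 / D) with hδ
    have hδ0 : 0 < δ := lt_min (by linarith) (by positivity)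
    have hδ1 : δ ≤ (m - y) / 2 := min_le_left _ _
    have hδ2 : δ * D ≤ k / 2 := (le_div_iff₀ hD0).1 (min_le_right _ _)
    refine ⟨y + δ, Real.exp (-k / 2), by linarith, by linarith, (Real.exp_pos _).le,
      Real.exp_lt_one_iff.2 (by linarith), ?_⟩
    intro n s hsn hs
    rw [← Real.exp_nat_mul, ← Real.exp_log (show 0 < v by linarith), ← Real.exp_log hu0,
      ← Real.exp_nat_mul, ← Real.exp_nat_mul, ← Real.exp_add, Real.exp_le_exp, Nat.cast_sub hsn]
    have h1 := mul_le_mul_of_nonneg_right hs hD0.le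
    have h2 := mul_le_mul_of_nonneg_left hδ2 (Nat.cast_nonneg (α := ℝ) n)
    have e1 : (s : ℝ) * Real.log v + (n - s) * Real.log u = n * Real.log u + s * D := by
      rw [hD]; ring
    have e2 : y * D + Real.log u = -k := by rw [hκ, hD]; ring
    rw [e1]
    have e3 : (n : ℝ) * (y * D + Real.log u) = n * -k := by rw [e2]
    nlinarith

/-! ### The posteriors -/

section Posterior

variable {K : ℕ} {ε : ℝ}

/-- The number of successes, rescaled by `1 - ε`. -/
def scaledSuccesses (ε : ℝ) (h : History K) (a : Fin K) : ℕ := ⌊(successes h a : ℝ) / (1 - ε)⌋₊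

lemma scaledSuccesses_le_pulls (h : History K) (a : Fin K)
    (hh : empMean h a ≤ 1 - ε) : scaledSuccesses ε h a ≤ pulls h a := by
  have h1 := betaParam_pos ε h a hh.not_gt
  unfold betaParam alphaParam at h1
  have h2 : ((scaledSuccesses ε h a : ℕ) : ℝ) < ((pulls h a + 1 : ℕ) : ℝ) := by
    push_cast; unfold scaledSuccesses; linarith
  exact Nat.lt_succ_iff.1 (by exact_mod_cast h2)

/-- Scaling only adds successes, so the tail of the posterior contains the binomial term at the true
number of successes. -/
lemma successes_le_scaledSuccesses (hε0 : 0 ≤ ε) (hε1 : ε < 1) (h : History K) (a : Fin K) :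
    successes h a ≤ scaledSuccesses ε h a := by
  refine Nat.le_floor ?_
  rw [le_div_iff₀ (by linarith)]
  nlinarith [Nat.cast_nonneg (α := ℝ) (successes h a)]

lemma empMean_le_of_successes_le {z : ℝ} (hz : 0 ≤ z) {h : History K} {a : Fin K}
    (hs : (successes h a : ℝ) ≤ z * pulls h a) : empMean h a ≤ z := by
  rw [empMean]
  exact div_le_of_le_mul₀ (Nat.cast_nonneg _) hz hs

lemma successes_le_of_empMean_le {z : ℝ} {h : History K} {a : Fin K}
    (hs : empMean h a ≤ z) : (successes h a : ℝ) ≤ z * pulls h a := by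
  rcases Nat.eq_zero_or_pos (pulls h a) with h0 | h0
  · have := successes_le_pulls h a
    have : successes h a = 0 := by omega
    simp [this, h0]
  · exact (div_le_iff₀ (by exact_mod_cast h0)).1 hs

lemma posterior_of_le (h : History K) (a : Fin K) (hh : empMean h a ≤ 1 - ε) :
    posterior ε h a = (betaMeasure ((scaledSuccesses ε h a : ℝ) + 1)
      ((pulls h a : ℝ) + 2 - (scaledSuccesses ε h a + 1))).map (fun y => (1 - ε) * y) := by
  rw [posterior, if_neg hh.not_gt]
  rfl

lemma posterior_inter_Ioi (hε1 : ε < 1) (h : History K) (a : Fin K) (hh : empMean h a ≤ 1 - ε)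
    (y : ℝ) {s : Set ℝ} (hs : MeasurableSet s) :
    posterior ε h a (s ∩ Set.Ioi y) = betaMeasure ((scaledSuccesses ε h a : ℝ) + 1)
      ((pulls h a : ℝ) + 2 - (scaledSuccesses ε h a + 1))
        ((fun y => (1 - ε) * y) ⁻¹' s ∩ Set.Ioi (y / (1 - ε))) := by
  rw [posterior_of_le h a hh, Measure.map_apply (by fun_prop) (hs.inter measurableSet_Ioi)]
  congr 1
  ext x
  simp only [Set.mem_preimage, Set.mem_inter_iff, Set.mem_Ioi]
  rw [div_lt_iff₀' (by linarith)]

lemma posterior_real_Ioi (hε1 : ε < 1) (h : History K) (a : Fin K) (hh : empMean h a ≤ 1 - ε)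
    {y : ℝ} (hy0 : 0 ≤ y) (hy1 : y ≤ 1 - ε) :
    (posterior ε h a).real (Set.Ioi y)
      = binCDF (pulls h a + 1) (scaledSuccesses ε h a) (y / (1 - ε)) := by
  have h0 : 0 ≤ y / (1 - ε) := div_nonneg hy0 (by linarith)
  have h1 : y / (1 - ε) ≤ 1 := (div_le_one (by linarith)).2 hy1
  have := posterior_inter_Ioi hε1 h a hh y MeasurableSet.univ
  rw [Set.preimage_univ, Set.univ_inter, Set.univ_inter,
    betaMeasure_Ioi (scaledSuccesses_le_pulls h a hh) h0 h1] at this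
  rw [Measure.real, this, ENNReal.toReal_ofReal (binCDF_nonneg _ _ h0 h1)]

lemma posterior_real_Ioi_of_lt (h : History K) (a : Fin K) (hh : 1 - ε < empMean h a)
    {y : ℝ} (hy1 : y ≤ 1 - ε) : (posterior ε h a).real (Set.Ioi y) = 1 := by
  rw [posterior, if_pos hh, Measure.real,
    Measure.dirac_apply_of_mem (show empMean h a ∈ Set.Ioi y from hy1.trans_lt hh),
    ENNReal.toReal_one]

lemma posterior_real_Ioi_pos (hε1 : ε < 1) (h : History K) (a : Fin K)
    {y : ℝ} (hy0 : 0 ≤ y) (hy1 : y < 1 - ε) : 0 < (posterior ε h a).real (Set.Ioi y) := by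
  rcases le_or_gt (empMean h a) (1 - ε) with hh | hh
  · rw [posterior_real_Ioi hε1 h a hh hy0 hy1.le]
    exact binCDF_pos _ _ (div_nonneg hy0 (by linarith)) ((div_lt_one (by linarith)).2 hy1)
  · rw [posterior_real_Ioi_of_lt h a hh hy1.le]; exact one_pos

lemma posterior_real_Ioi_le_exp (hε1 : ε < 1) (h : History K) (a : Fin K) {z y : ℝ}
    (hz : 0 < z) (hzy : z < y) (hy : y < 1 - ε) (hs : (successes h a : ℝ) ≤ z * pulls h a) :
    (posterior ε h a).real (Set.Ioi y)
      ≤ Real.exp (-(pulls h a * klReal (z / (1 - ε)) (y / (1 - ε)))) := by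
  have hr : 0 < 1 - ε := by linarith
  have hh : empMean h a ≤ 1 - ε := (empMean_le_of_successes_le hz.le hs).trans (by linarith)
  rw [posterior_real_Ioi hε1 h a hh (by linarith) hy.le]
  refine binCDF_le_exp (scaledSuccesses_le_pulls h a hh) (div_pos hz hr)
    (div_lt_div_of_pos_right hzy hr) ((div_lt_one hr).2 hy) ?_
  refine (Nat.floor_le (by positivity)).trans ?_
  rw [div_mul_eq_mul_div]
  gcongr

lemma lowOdds_nonneg (y : ℝ) (h : History K) (o : Fin K) : 0 ≤ lowOdds ε y h o :=
  div_nonneg (sub_nonneg.2 measureReal_le_one) measureReal_nonneg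

lemma lowOdds_of_lt (h : History K) (o : Fin K) (hh : 1 - ε < empMean h o)
    {y : ℝ} (hy1 : y ≤ 1 - ε) : lowOdds ε y h o = 0 := by
  rw [lowOdds, posterior_real_Ioi_of_lt h o hh hy1, sub_self, zero_div]

/-- Crude, but valid for every sequence of rewards; it covers histories in which `o` has few plays.
-/
lemma lowOdds_le_inv_pow (hε1 : ε < 1) (h : History K) (o : Fin K)
    {y : ℝ} (hy0 : 0 ≤ y) (hy1 : y < 1 - ε) :
    lowOdds ε y h o ≤ ((1 - y / (1 - ε)) ^ (pulls h o + 1))⁻¹ := by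
  have h0 : 0 ≤ y / (1 - ε) := div_nonneg hy0 (by linarith)
  have h1 : y / (1 - ε) < 1 := (div_lt_one (by linarith)).2 hy1
  have hpos := pow_pos (sub_pos.2 h1) (pulls h o + 1)
  rcases le_or_gt (empMean h o) (1 - ε) with hh | hh
  · rw [lowOdds, posterior_real_Ioi hε1 h o hh hy0 hy1.le, ← one_div]
    have h2 := pow_le_binCDF (pulls h o + 1) (scaledSuccesses ε h o) h0 h1.le
    have h3 := binCDF_nonneg (pulls h o + 1) (scaledSuccesses ε h o) h0 h1.le
    exact div_le_div₀ zero_le_one (by linarith) hpos h2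
  · rw [lowOdds_of_lt h o hh hy1.le]
    exact inv_nonneg.2 hpos.le

/-- If the optimistic arm has an empirical mean well above `y`, then the odds that its index
falls below `y` are exponentially small. -/
lemma exists_lowOdds_le_geometric (K : ℕ) (hε1 : ε < 1) {y t : ℝ} (hy0 : 0 ≤ y) (hy1 : y < 1 - ε)
    (hyt : y / (1 - ε) < t) (ht : t ≤ 1) :
    ∃ C : ℝ, 0 ≤ C ∧ ∀ (h : History K) (o : Fin K), t * pulls h o ≤ scaledSuccesses ε h o + 1 →
      lowOdds ε y h o ≤ C * rate (y / (1 - ε)) t ^ pulls h o := by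
  have h0 : 0 ≤ y / (1 - ε) := div_nonneg hy0 (by linarith)
  have h1 : y / (1 - ε) < 1 := hyt.trans_le ht
  have h1' := sub_pos.2 h1
  set ρ := rate (y / (1 - ε)) t with hρ
  have hρ0 : 0 < ρ := rate_pos _ _
  have hρ1 : ρ < 1 := rate_lt_one hyt.ne
  -- From `N` plays on, `1 - F ≤ 3 * ρ ^ n ≤ 1 / 2`, so the odds are at most `6 * ρ ^ n`; before
  -- that, `F` is bounded below by a power.
  obtain ⟨N, hN⟩ := exists_pow_lt_of_lt_one (show (0 : ℝ) < 1 / 6 by norm_num) hρ1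
  refine ⟨6 + 3 * ((1 - y / (1 - ε)) ^ (N + 1))⁻¹, by positivity, fun h o hso => ?_⟩
  rcases le_or_gt (empMean h o) (1 - ε) with hh | hh
  · rw [lowOdds, posterior_real_Ioi hε1 h o hh hy0 hy1.le]
    set n := pulls h o
    set F := binCDF (n + 1) (scaledSuccesses ε h o) (y / (1 - ε)) with hF
    have h2 : 1 - F ≤ 3 * ρ ^ n :=
      one_sub_binCDF_le (scaledSuccesses_le_pulls h o hh) h0 hyt.le ht hso
    have hFpos : 0 < F := binCDF_pos _ _ h0 h1
    have hρn : 0 < ρ ^ n := pow_pos hρ0 n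
    rw [div_le_iff₀ hFpos]
    refine h2.trans ?_
    suffices H : 3 ≤ (6 + 3 * ((1 - y / (1 - ε)) ^ (N + 1))⁻¹) * F by
      have := mul_le_mul_of_nonneg_right H hρn.le
      linarith
    rw [add_mul]
    rcases le_or_gt N n with hNn | hNn
    · have h3 : ρ ^ n ≤ ρ ^ N := pow_le_pow_of_le_one hρ0.le hρ1.le hNn
      have h4 : 0 ≤ 3 * ((1 - y / (1 - ε)) ^ (N + 1))⁻¹ * F := by positivity
      linarith
    · have h3 := pow_le_binCDF (n + 1) (scaledSuccesses ε h o) h0 h1.le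
      have h4 : (1 - y / (1 - ε)) ^ (N + 1) ≤ (1 - y / (1 - ε)) ^ (n + 1) :=
        pow_le_pow_of_le_one h1'.le (by linarith) (by omega)
      have h5 : 1 ≤ ((1 - y / (1 - ε)) ^ (N + 1))⁻¹ * F := by
        rw [inv_mul_eq_div, one_le_div (by positivity)]
        exact h4.trans h3
      linarith
  · rw [lowOdds_of_lt h o hh hy1.le]
    positivity

lemma exists_lowOdds_le_of_not_underestimated (K : ℕ) (hε1 : ε < 1) {y w : ℝ} (hy0 : 0 ≤ y)
    (hyw : y < w) (hw : w ≤ 1 - ε) (m : ℕ) :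
    ∃ C ρ : ℝ, 0 ≤ C ∧ 0 ≤ ρ ∧ ρ < 1 ∧ ∀ (h : History K) (o : Fin K),
      ¬ (m ≤ pulls h o ∧ (successes h o : ℝ) ≤ w * pulls h o) →
        lowOdds ε y h o ≤ C * ρ ^ pulls h o := by
  have hr : 0 < 1 - ε := by linarith
  have hy1 : y < 1 - ε := hyw.trans_le hw
  have hyw' : y / (1 - ε) < w / (1 - ε) := div_lt_div_of_pos_right hyw hr
  have hw' : w / (1 - ε) ≤ 1 := (div_le_one hr).2 hw
  obtain ⟨C, hC0, hC⟩ := exists_lowOdds_le_geometric K hε1 hy0 hy1 hyw' hw'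
  set ρ := rate (y / (1 - ε)) (w / (1 - ε)) with hρ
  have hρ0 : 0 < ρ := rate_pos _ _
  have hρ1 : ρ < 1 := rate_lt_one hyw'.ne
  have hx0 : 0 ≤ y / (1 - ε) := by positivity
  have hx1 : 0 < 1 - y / (1 - ε) := by linarith
  refine ⟨C + ((1 - y / (1 - ε)) ^ (m + 1))⁻¹ * (ρ ^ m)⁻¹, ρ, by positivity, hρ0.le, hρ1,
    fun h o hho => ?_⟩
  rw [add_mul]
  by_cases hm : m ≤ pulls h o
  · have hs : w * pulls h o < successes h o := not_le.1 fun hs => hho ⟨hm, hs⟩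
    refine (hC h o ?_).trans (le_add_of_nonneg_right (by positivity))
    have h1 := (Nat.lt_floor_add_one ((successes h o : ℝ) / (1 - ε))).le
    refine le_trans ?_ h1
    rw [div_mul_eq_mul_div]
    gcongr
  · rw [not_le] at hm
    refine (lowOdds_le_inv_pow hε1 h o hy0 hy1).trans
      (le_trans ?_ (le_add_of_nonneg_left (by positivity)))
    have h1 : ((1 - y / (1 - ε)) ^ (pulls h o + 1))⁻¹ ≤ ((1 - y / (1 - ε)) ^ (m + 1))⁻¹ := by
      refine inv_anti₀ (by positivity) (pow_le_pow_of_le_one hx1.le (by linarith) (by omega))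
    have h2 : 1 ≤ (ρ ^ m)⁻¹ * ρ ^ pulls h o := by
      rw [inv_mul_eq_div, one_le_div (by positivity)]
      exact pow_le_pow_of_le_one hρ0.le hρ1.le hm.le
    rw [mul_assoc]
    exact h1.trans (le_mul_of_one_le_right (by positivity) h2)

end Posterior

/-! ### Underestimation of the optimal arm -/

lemma exists_sum_mul_geometric_le {ρ : ℝ} (h0 : 0 ≤ ρ) (h1 : ρ < 1) :
    ∃ M : ℝ, ∀ T : ℕ, ∑ j ∈ Finset.range T, ((j : ℝ) + 1) * ρ ^ j ≤ M := by
  have hs : Summable (fun j : ℕ => ((j : ℝ) + 1) * ρ ^ j) := by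
    have ha := summable_pow_mul_geometric_of_norm_lt_one 1
      (show ‖ρ‖ < 1 by rwa [Real.norm_eq_abs, abs_of_nonneg h0])
    have hb := summable_geometric_of_lt_one h0 h1
    refine (ha.add hb).congr fun j => by ring
  exact ⟨_, fun T => hs.sum_le_tsum _ (fun j _ => by positivity)⟩

namespace Bandit

variable {K : ℕ} [NeZero K]

/-- The expected number of plays lost because the index of an arm falls below a threshold `y`
with `y / (1 - ε)` smaller than its mean is bounded. -/
lemma exists_total_lowOdds_le (B : Bandit K) {ε : ℝ} (hε0 : 0 ≤ ε) (hε1 : ε < 1) (o : Fin K)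
    {y : ℝ} (hy0 : 0 < y) (hym : y / (1 - ε) < B.mean o) :
    ∃ M : ℝ, ∀ T, B.total ε T (fun h => playProb ε h o * lowOdds ε y h o) ≤ M := by
  have hr : 0 < 1 - ε := by linarith
  set x := y / (1 - ε) with hx
  have hx0 : 0 < x := div_pos hy0 hr
  have hm1 := B.mean_le_one o
  have hx1 : x < 1 := hym.trans_le hm1
  have hx1' : 0 < 1 - x := sub_pos.2 hx1
  have hy1 : y < 1 - ε := (div_lt_one hr).1 hx1
  obtain ⟨t, ρ, hxt, htm, hρ0, hρ1, hlr⟩ := exists_likelihood_ratio_le hx0 hym hm1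
  obtain ⟨C, hC0, hC⟩ := exists_lowOdds_le_geometric K hε1 hy0.le hy1 hxt (htm.le.trans hm1)
  rw [← hx] at hC
  obtain ⟨M, hM⟩ := exists_sum_mul_geometric_le hρ0 hρ1
  -- The reciprocal of one binomial term bounds the odds when `s ≤ t * n`; for larger `s` they decay
  -- geometrically.
  set g : ℕ → ℕ → ℝ := fun n s => if s ≤ n ∧ (s : ℝ) ≤ t * n then
    (((n + 1).choose s : ℝ) * x ^ s * (1 - x) ^ (n + 1 - s))⁻¹ else 0 with hg
  have hg0 : ∀ n s, 0 ≤ g n s := by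
    intro n s
    simp only [hg]
    split_ifs <;> positivity
  set c : History K → ℝ := fun h => C * rate x t ^ pulls h o with hc
  refine ⟨C / (1 - rate x t) + (1 - x)⁻¹ * M, fun T => ?_⟩
  have h1 : B.total ε T (fun h => playProb ε h o * c h) ≤ C / (1 - rate x t) := by
    have := B.total_play_le_of_contraction ε o (c := c) (w := fun n _ => C * rate x t ^ n)
      (rate_lt_one hxt.ne) (fun n _ => mul_nonneg hC0 (pow_pos (rate_pos _ _) n).le)
      (fun n s => le_of_eq (by rw [trial]; ring)) (fun h => le_rfl) T
    simpa using this
  have h2 : B.total ε T (fun h => playProb ε h o * g (pulls h o) (successes h o))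
      ≤ (1 - x)⁻¹ * M := by
    refine (B.total_play_le_sum_trial ε o hg0 T).trans ?_
    refine le_trans (Finset.sum_le_sum fun j _ => (?_ : _ ≤ (1 - x)⁻¹ * (((j : ℝ) + 1) * ρ ^ j))) ?_
    · rw [iterate_trial]
      refine (Finset.sum_le_card_nsmul _ _ ((1 - x)⁻¹ * ρ ^ j) fun i hi => ?_).trans
        (le_of_eq (by rw [Finset.card_range, nsmul_eq_mul]; push_cast; ring))
      have hij : i ≤ j := Nat.lt_succ_iff.1 (Finset.mem_range.1 hi)
      simp only [zero_add, hg]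
      split_ifs with hcond
      · have hl := hlr j i hij hcond.2
        have hch : (j.choose i : ℝ) ≤ ((j + 1).choose i : ℝ) := by
          exact_mod_cast Nat.choose_le_choose i (Nat.le_succ j)
        have hchpos : (0 : ℝ) < (j + 1).choose i := by
          exact_mod_cast Nat.choose_pos (by omega)
        have hm0 := B.mean_nonneg o
        have hm1' := sub_nonneg.2 hm1
        -- Change of measure: averaging the reciprocal under the true mean leaves a likelihood
        -- ratio, a quotient of binomial coefficients that is at most 1, and one spare `1 - x`.
        have e1 : (j.choose i : ℝ) * B.mean o ^ i * (1 - B.mean o) ^ (j - i)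
            * (((j + 1).choose i : ℝ) * x ^ i * (1 - x) ^ (j + 1 - i))⁻¹
            = (j.choose i : ℝ) / (j + 1).choose i * ((1 - x)⁻¹ *
              ((B.mean o / x) ^ i * ((1 - B.mean o) / (1 - x)) ^ (j - i))) := by
          rw [show j + 1 - i = (j - i) + 1 by omega, pow_succ]
          clear_value x
          simp only [div_pow]
          field_simp
        rw [e1]
        refine (mul_le_of_le_one_left (by positivity) ((div_le_one hchpos).2 hch)).trans ?_
        gcongr
      · rw [mul_zero]; positivity
    · rw [← Finset.mul_sum]
      exact mul_le_mul_of_nonneg_left (hM T) (by positivity)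
  refine le_trans ?_ (add_le_add h1 h2)
  rw [← total_add]
  refine B.total_mono ε T fun h => ?_
  rw [← mul_add]
  refine mul_le_mul_of_nonneg_left ?_ (playProb_nonneg _ _ _)
  have hsk := successes_le_scaledSuccesses hε0 hε1 h o
  have hsk' : (successes h o : ℝ) ≤ scaledSuccesses ε h o := by exact_mod_cast hsk
  have hc0 : 0 ≤ c h := mul_nonneg hC0 (pow_pos (rate_pos _ _) _).le
  rcases le_or_gt (successes h o : ℝ) (t * pulls h o) with hs | hs
  · refine le_trans ?_ (le_add_of_nonneg_left hc0)
    rcases le_or_gt (empMean h o) (1 - ε) with hh | hh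
    · have hsn := successes_le_pulls h o
      simp only [hg]
      rw [if_pos ⟨hsn, hs⟩, lowOdds, posterior_real_Ioi hε1 h o hh hy0.le hy1.le, ← one_div,
        ← hx]
      have hch : (0 : ℝ) < (pulls h o + 1).choose (successes h o) := by
        exact_mod_cast Nat.choose_pos (by omega)
      refine div_le_div₀ zero_le_one ?_ (by positivity) (term_le_binCDF _ hsk hx0.le hx1.le)
      linarith [binCDF_nonneg (pulls h o + 1) (scaledSuccesses ε h o) hx0.le hx1.le]
    · rw [lowOdds_of_lt h o hh hy1.le]; exact hg0 _ _
  · refine le_trans ?_ (le_add_of_nonneg_right (hg0 _ _))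
    exact hC h o (by linarith)

end Bandit

/-! ### Domination of the posterior of a well-explored bad arm -/

/-- The last hypothesis puts the mode `k / (k + l)` at or to the left of `y`, beyond which the
function decreases; the proof uses `1 + u ≤ exp u` for both ratios. -/
lemma pow_mul_one_sub_pow_le {k l : ℕ} {x y : ℝ} (hy0 : 0 < y) (hyx : y ≤ x) (hx : x < 1)
    (hkl : (k : ℝ) * (1 - y) ≤ l * y) :
    x ^ k * (1 - x) ^ l ≤ y ^ k * (1 - y) ^ l := by
  have hy1 : 0 < 1 - y := by linarith
  have hx1 : 0 < 1 - x := by linarith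
  have hx0 : 0 < x := by linarith
  have h1 : (x / y) ^ k ≤ Real.exp (k * ((x - y) / y)) := by
    rw [Real.exp_nat_mul]
    refine pow_le_pow_left₀ (by positivity) ?_ k
    have := Real.add_one_le_exp ((x - y) / y)
    rwa [show (x - y) / y + 1 = x / y by rw [sub_div, div_self hy0.ne', sub_add_cancel]] at this
  have h2 : ((1 - x) / (1 - y)) ^ l ≤ Real.exp (l * ((y - x) / (1 - y))) := by
    rw [Real.exp_nat_mul]
    refine pow_le_pow_left₀ (by positivity) ?_ l
    have := Real.add_one_le_exp ((y - x) / (1 - y))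
    rwa [show (y - x) / (1 - y) + 1 = (1 - x) / (1 - y) by field_simp; ring] at this
  have h3 : (x / y) ^ k * ((1 - x) / (1 - y)) ^ l ≤ 1 := by
    refine (mul_le_mul h1 h2 (by positivity) (Real.exp_pos _).le).trans ?_
    rw [← Real.exp_add, Real.exp_le_one_iff]
    have e : (k : ℝ) * ((x - y) / y) + l * ((y - x) / (1 - y))
        = (x - y) * (k * (1 - y) - l * y) / (y * (1 - y)) := by field_simp; ring
    rw [e]
    exact div_nonpos_of_nonpos_of_nonneg
      (mul_nonpos_of_nonneg_of_nonpos (by linarith) (by linarith)) (by positivity)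
  rw [div_pow, div_pow, div_mul_div_comm, div_le_one (by positivity)] at h3
  exact h3

lemma binCDF_le_rate_pow {j k : ℕ} (hk : k ≤ j) {z y : ℝ} (hz : 0 ≤ z) (hzy : z ≤ y) (hy : y ≤ 1)
    (hkz : (k : ℝ) ≤ z * j) : binCDF j k y ≤ rate y z ^ j := by
  have hy0 : 0 ≤ y := hz.trans hzy
  have hx : (z - y) / 2 ≤ 0 := by linarith
  have h1 := binCDF_mul_pow_le hk hy0 hy (Real.exp_pos _).le (Real.exp_le_one_iff.2 hx)
  have h2 : (1 - y + y * Real.exp ((z - y) / 2)) ^ j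
      ≤ (Real.exp (z * ((z - y) / 2)) * rate y z) ^ j :=
    pow_le_pow_left₀ (add_nonneg (sub_nonneg.2 hy) (mul_nonneg hy0 (Real.exp_pos _).le))
      (bernoulli_mgf_le hy0 hy hz (hzy.trans hy)) _
  have h3 := h1.trans h2
  rw [mul_pow, ← Real.exp_nat_mul, ← Real.exp_nat_mul] at h3
  have h4 : Real.exp (j * (z * ((z - y) / 2))) ≤ Real.exp (k * ((z - y) / 2)) :=
    Real.exp_le_exp.2 (by nlinarith)
  have h5 := h3.trans (mul_le_mul_of_nonneg_right h4 (pow_pos (rate_pos y z) j).le)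
  rw [mul_comm] at h5
  exact le_of_mul_le_mul_left h5 (Real.exp_pos _)

/-- Reserve `n` of the factors `1 - x`. The rest of the density of the well-explored arm is past its
mode at `y`, hence largest there, and exponentially small by Chernoff. The reserved factors and `y ^
n` lie below the other density, whatever `k'` is. -/
lemma beta_density_le {j k n k' : ℕ} (hk' : k' ≤ n) {z y x : ℝ} (hz : 0 ≤ z) (hzy : z < y)
    (hyx : y ≤ x) (hx : x < 1) (hkz : (k : ℝ) ≤ z * j) (hn : (n : ℝ) * y ≤ j * (y - z)) :
    ((j : ℝ) + 1) * j.choose k * x ^ k * (1 - x) ^ (j - k)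
      ≤ ((j + 1) * rate y z ^ j * ((y * (1 - y)) ^ n)⁻¹)
        * ((n + 1) * n.choose k' * x ^ k' * (1 - x) ^ (n - k')) := by
  have hy0 : 0 < y := hz.trans_lt hzy
  have hy1 : 0 < 1 - y := by linarith
  have hx1 : 0 < 1 - x := by linarith
  have hx0 : 0 < x := by linarith
  have hkn : k + n ≤ j := by
    have h0 := Nat.cast_nonneg (α := ℝ) k
    have : ((k : ℝ) + n) * y ≤ j * y := by nlinarith
    exact_mod_cast le_of_mul_le_mul_right this hy0
  obtain ⟨l, rfl⟩ : ∃ l, j = k + n + l := ⟨j - (k + n), by omega⟩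
  set j := k + n + l with hj
  have hjr : (j : ℝ) = k + n + l := by rw [hj]; push_cast; ring
  have e1 : j - k = l + n := by omega
  have hA := pow_mul_one_sub_pow_le (k := k) (l := l) hy0 hyx hx (by
    have : (n : ℝ) * y ≤ j * y - k := by nlinarith
    rw [hjr] at this
    nlinarith)
  have hB := (term_le_binCDF j (le_refl k) hy0.le (by linarith)).trans
    (binCDF_le_rate_pow (by omega) hz hzy.le (by linarith) hkz)
  rw [e1] at hB ⊢
  have hC : y ^ n * (1 - x) ^ n ≤ (n + 1) * n.choose k' * x ^ k' * (1 - x) ^ (n - k') := by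
    have c1 : y ^ n ≤ x ^ k' :=
      (pow_le_pow_left₀ hy0.le hyx n).trans (pow_le_pow_of_le_one hx0.le hx.le hk')
    have c2 : (1 - x) ^ n ≤ (1 - x) ^ (n - k') :=
      pow_le_pow_of_le_one hx1.le (by linarith) (by omega)
    have c3 : (1 : ℝ) ≤ (n + 1) * n.choose k' := by
      have : (1 : ℝ) ≤ n.choose k' := by exact_mod_cast Nat.choose_pos hk'
      nlinarith [Nat.cast_nonneg (α := ℝ) n]
    calc y ^ n * (1 - x) ^ n ≤ x ^ k' * (1 - x) ^ (n - k') :=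
          mul_le_mul c1 c2 (by positivity) (by positivity)
      _ ≤ ((n + 1) * n.choose k') * (x ^ k' * (1 - x) ^ (n - k')) :=
          le_mul_of_one_le_left (by positivity) c3
      _ = _ := by ring
  have hρ := pow_pos (rate_pos y z) j
  calc ((j : ℝ) + 1) * j.choose k * x ^ k * (1 - x) ^ (l + n)
      = (j + 1) * j.choose k * (x ^ k * (1 - x) ^ l) * (1 - x) ^ n := by rw [pow_add]; ring
    _ ≤ (j + 1) * j.choose k * (y ^ k * (1 - y) ^ l) * (1 - x) ^ n := by gcongr
    _ = (j + 1) * (j.choose k * y ^ k * (1 - y) ^ (l + n)) * ((1 - y) ^ n)⁻¹ * (1 - x) ^ n := by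
        rw [pow_add]; field_simp
    _ ≤ (j + 1) * rate y z ^ j * ((1 - y) ^ n)⁻¹ * (1 - x) ^ n := by gcongr
    _ = ((j + 1) * rate y z ^ j * ((y * (1 - y)) ^ n)⁻¹) * (y ^ n * (1 - x) ^ n) := by
        rw [mul_pow]; field_simp
    _ ≤ _ := by gcongr

lemma betaMeasure_inter_Ioi_le {j k n k' : ℕ} (hk : k ≤ j) (hk' : k' ≤ n) {y r : ℝ} (hr : 0 ≤ r)
    (hy0 : 0 ≤ y) (hle : ∀ x, y < x → x < 1 → ((j : ℝ) + 1) * j.choose k * x ^ k * (1 - x) ^ (j - k)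
      ≤ r * ((n + 1) * n.choose k' * x ^ k' * (1 - x) ^ (n - k')))
    {s : Set ℝ} (hs : MeasurableSet s) :
    betaMeasure ((k : ℝ) + 1) ((j : ℝ) + 2 - (k + 1)) (s ∩ Set.Ioi y)
      ≤ ENNReal.ofReal r
        * betaMeasure ((k' : ℝ) + 1) ((n : ℝ) + 2 - (k' + 1)) (s ∩ Set.Ioi y) := by
  have hms : MeasurableSet (s ∩ Set.Ioi y) := hs.inter measurableSet_Ioi
  have hm : ∀ α β : ℝ, Measurable (betaPDF α β) := fun α β =>
    (measurable_betaPDFReal α β).ennreal_ofReal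
  rw [betaMeasure, betaMeasure, withDensity_apply _ hms, withDensity_apply _ hms,
    ← lintegral_const_mul _ (hm _ _)]
  refine setLIntegral_mono' hms fun x hx => ?_
  have hyx : y < x := hx.2
  rcases lt_or_ge x 1 with hx1 | hx1
  · rw [betaPDF_nat hk (hy0.trans_lt hyx) hx1, betaPDF_nat hk' (hy0.trans_lt hyx) hx1,
      ← ENNReal.ofReal_mul hr]
    exact ENNReal.ofReal_le_ofReal (hle x hyx hx1)
  · rw [betaPDF_eq_zero_of_one_le hx1]; exact zero_le

/-- An arm that has been played much more often than another one, with an empirical mean below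
`z < y`, has a posterior that is dominated beyond `y` by the posterior of the other arm. -/
lemma exists_posterior_dominated (K : ℕ) {ε : ℝ} (hε1 : ε < 1) {z y : ℝ} (hz : 0 < z)
    (hzy : z < y) (hy : y < 1 - ε) :
    ∃ (κ : ℕ) (C : ℝ), 0 ≤ C ∧ ∀ (h : History K) (a o : Fin K),
      (successes h a : ℝ) ≤ z * pulls h a → empMean h o ≤ 1 - ε →
      κ * (pulls h o + 1) ≤ pulls h a →
      1 / 2 ≤ (posterior ε h a).real (Set.Iic y) ∧
      ∀ s, MeasurableSet s → posterior ε h a (s ∩ Set.Ioi y)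
        ≤ ENNReal.ofReal (C * (1 / 2) ^ pulls h o) * posterior ε h o (s ∩ Set.Ioi y) := by
  have hr : 0 < 1 - ε := by linarith
  set z' := z / (1 - ε) with hz'
  set y' := y / (1 - ε) with hy'
  have hz'0 : 0 < z' := div_pos hz hr
  have hzy' : z' < y' := div_lt_div_of_pos_right hzy hr
  have hy'1 : y' < 1 := (div_lt_one hr).2 hy
  have hy'0 : 0 < y' := hz'0.trans hzy'
  -- The square root of `rate y' z'`: one power `σ ^ j` absorbs the factor `j + 1`, the other beats
  -- `D ^ (-n)`.
  set σ := Real.exp (-(z' - y') ^ 2 / 8) with hσ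
  have hσ0 : 0 < σ := Real.exp_pos _
  have hσ1 : σ < 1 := by
    rw [hσ, Real.exp_lt_one_iff]
    have := sq_pos_of_ne_zero (sub_ne_zero.2 hzy'.ne)
    linarith
  have hrate : ∀ j : ℕ, rate y' z' ^ j = σ ^ j * σ ^ j := by
    intro j
    rw [← mul_pow]
    congr 1
    rw [hσ, ← Real.exp_add, rate]
    congr 1
    ring
  set D := y' * (1 - y') with hD
  have hD0 : 0 < D := mul_pos hy'0 (sub_pos.2 hy'1)
  obtain ⟨M, hM⟩ := exists_sum_mul_geometric_le hσ0.le hσ1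
  have hMj : ∀ j : ℕ, ((j : ℝ) + 1) * σ ^ j ≤ M := fun j => by
    refine le_trans ?_ (hM (j + 1))
    exact Finset.single_le_sum (f := fun j : ℕ => ((j : ℝ) + 1) * σ ^ j)
      (fun i _ => by positivity) (Finset.mem_range.2 (Nat.lt_succ_self j))
  have hM0 : 0 ≤ M := by simpa using hM 0
  obtain ⟨κ₁, hκ₁⟩ := exists_pow_lt_of_lt_one (show 0 < D / 2 by positivity) hσ1
  obtain ⟨κ₂, hκ₂⟩ := exists_nat_ge (y' / (y' - z'))
  have hkl : 0 < klReal z' y' := klReal_pos hz'0 (hzy'.trans hy'1) hy'0 hy'1 hzy'.ne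
  obtain ⟨κ₃, hκ₃⟩ := exists_nat_ge (1 / klReal z' y')
  -- `κ₁` makes the ratio `2 ^ (-n)`, `κ₂` leaves room for the reserved factors, and `κ₃` puts half
  -- of the mass below `y`, even when `n = 0`.
  refine ⟨κ₁ + κ₂ + κ₃, M, hM0, fun h a o hsa hho hpulls => ?_⟩
  set j := pulls h a with hj
  set n := pulls h o with hn
  have hha : empMean h a ≤ 1 - ε := (empMean_le_of_successes_le hz.le hsa).trans (by linarith)
  have hκ₁' : κ₁ * n ≤ j := le_trans (by nlinarith) hpulls
  have hκ₂' : κ₂ * n ≤ j := le_trans (by nlinarith) hpulls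
  have hκ₃' : κ₃ ≤ j := le_trans (by nlinarith) hpulls
  constructor
  · have h1 := posterior_real_Ioi_le_exp hε1 h a hz hzy hy hsa
    rw [← Set.compl_Ioi, probReal_compl_eq_one_sub measurableSet_Ioi]
    have h2 : 1 ≤ (j : ℝ) * klReal z' y' := by
      rw [div_le_iff₀ hkl] at hκ₃
      have : (κ₃ : ℝ) ≤ j := by exact_mod_cast hκ₃'
      nlinarith
    have h3 : Real.exp (-(j * klReal z' y')) ≤ 1 / 2 := by
      refine (Real.exp_le_exp.2 (neg_le_neg h2)).trans ?_
      rw [Real.exp_neg, ← one_div]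
      refine one_div_le_one_div_of_le (by norm_num) ?_
      have := Real.add_one_le_exp 1
      linarith
    linarith
  · intro s hs
    rw [posterior_inter_Ioi hε1 h a hha y hs, posterior_inter_Ioi hε1 h o hho y hs]
    have hk := scaledSuccesses_le_pulls h a hha
    have hk' := scaledSuccesses_le_pulls h o hho
    refine betaMeasure_inter_Ioi_le hk hk' (by positivity) hy'0.le (fun x hyx hx1 => ?_)
      (measurable_const_mul _ hs)
    have hkz : (scaledSuccesses ε h a : ℝ) ≤ z' * j := by
      refine (Nat.floor_le (by positivity)).trans ?_
      rw [hz', div_mul_eq_mul_div]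
      gcongr
    have hny : (n : ℝ) * y' ≤ j * (y' - z') := by
      rw [div_le_iff₀ (by linarith)] at hκ₂
      have h1 : (κ₂ : ℝ) * n ≤ j := by exact_mod_cast hκ₂'
      have h2 := mul_le_mul_of_nonneg_right h1 (sub_pos.2 hzy').le
      have h3 := mul_le_mul_of_nonneg_left hκ₂ (Nat.cast_nonneg (α := ℝ) n)
      linarith
    refine (beta_density_le hk' hz'0.le hzy' hyx.le hx1 hkz hny).trans ?_
    have hx0 : 0 < x := hy'0.trans hyx
    have hx1' : 0 < 1 - x := sub_pos.2 hx1
    refine mul_le_mul_of_nonneg_right ?_ (by positivity)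
    have h1 : σ ^ j ≤ (D / 2) ^ n := by
      refine (pow_le_pow_of_le_one hσ0.le hσ1.le hκ₁').trans ?_
      rw [pow_mul]
      exact pow_le_pow_left₀ (by positivity) hκ₁.le n
    calc ((j : ℝ) + 1) * rate y' z' ^ j * ((y' * (1 - y')) ^ n)⁻¹
        = (((j : ℝ) + 1) * σ ^ j) * (σ ^ j * (D ^ n)⁻¹) := by rw [hrate]; ring
      _ ≤ M * ((D / 2) ^ n * (D ^ n)⁻¹) := by gcongr; exact hMj j
      _ = M * (1 / 2) ^ n := by
        congr 1
        rw [div_pow, div_pow, one_pow]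
        field_simp

/-! ### Plays of the bad arms -/

namespace Bandit

variable {K : ℕ} [NeZero K]

/-- From `μ_a < μ* - ε` and `μ* ≤ 1`. This opens the interval of thresholds `y > μ_a` with `y / (1 -
ε) < μ*`. -/
lemma mean_lt_of_lt_gap (B : Bandit K) {ε : ℝ} (hε0 : 0 ≤ ε) {a : Fin K} (ha : ε < B.gap a) :
    B.mean a < B.optMean * (1 - ε) := by
  have := B.optMean_le_one
  unfold gap at ha
  nlinarith

lemma exists_total_overestimated_le (B : Bandit K) (ε : ℝ) (a : Fin K) {z : ℝ}
    (hz : B.mean a < z) (hz1 : z ≤ 1) :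
    ∃ M : ℝ, ∀ T, B.total ε T (fun h => playProb ε h a *
      (open Classical in if z * pulls h a < successes h a then 1 else 0)) ≤ M := by
  classical
  refine ⟨_, fun T => B.total_play_le_of_contraction ε a (w := tilt (B.mean a) z)
    (rate_lt_one hz.ne) (fun n s => (tilt_pos _ _ _ _).le)
    (trial_tilt_le (B.mean_nonneg a) (B.mean_le_one a) ((B.mean_nonneg a).trans hz.le) hz1)
    (fun h => ?_) T⟩
  split_ifs with hs
  · exact one_le_tilt_of_ge hz.le hs.le
  · exact (tilt_pos _ _ _ _).le

lemma total_geometric_le (B : Bandit K) (ε : ℝ) (o : Fin K) {C ρ : ℝ} (hC : 0 ≤ C) (hρ0 : 0 ≤ ρ)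
    (hρ1 : ρ < 1) (T : ℕ) :
    B.total ε T (fun h => playProb ε h o * (C * ρ ^ pulls h o)) ≤ C / (1 - ρ) := by
  have := B.total_play_le_of_contraction ε o (c := fun h => C * ρ ^ pulls h o)
    (w := fun n _ => C * ρ ^ n) hρ1 (fun n _ => by positivity)
    (fun n s => le_of_eq (by rw [trial]; ring)) (fun h => le_rfl) T
  simpa using this

/-- If the optimal mean exceeds `1 - ε`, a bad arm is seldom played while the optimal arm
looks bad and has been played a comparable number of times. -/
lemma exists_total_underestimated_le (B : Bandit K) {ε : ℝ} (hε1 : ε < 1)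
    {a o : Fin K} (hao : a ≠ o) (ho : 1 - ε < B.mean o) (κ : ℕ) :
    ∃ M : ℝ, ∀ T, B.total ε T (fun h => playProb ε h a * (open Classical in
      if empMean h o ≤ 1 - ε ∧ pulls h a < κ * (pulls h o + 1) then 1 else 0)) ≤ M := by
  classical
  have hr : 0 < 1 - ε := by linarith
  set p := B.mean o with hp
  have hp0 := B.mean_nonneg o
  have hp1 := B.mean_le_one o
  set R := (1 - ε - p) ^ 2 / 4 with hR
  have hR0 : 0 < R := by
    have := sq_pos_of_ne_zero (sub_ne_zero.2 ho.ne)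
    rw [hR]; linarith
  -- Chosen so that `q ^ κ` is at least the contraction rate of the weights; they remain a
  -- supermartingale when inflated by `q ^ (-κ)` per play of `o`.
  set q := Real.exp (-(R / (κ + 1))) with hq
  have hq0 : 0 < q := Real.exp_pos _
  have hq1 : q < 1 := by
    rw [hq, Real.exp_lt_one_iff]
    have : 0 < R / (κ + 1) := by positivity
    linarith
  have hqκ : rate p (1 - ε) ≤ q ^ κ := by
    rw [rate, hq, ← Real.exp_nat_mul, Real.exp_le_exp, neg_div, ← hR, mul_neg, neg_le_neg_iff,
      mul_div_assoc', div_le_iff₀ (by positivity)]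
    nlinarith
  set u : ℕ → ℕ → ℝ := fun n s => (q ^ (κ * (n + 1)))⁻¹ * tilt p (1 - ε) n s with hu
  have hu0 : ∀ n s, 0 ≤ u n s := fun n s => mul_nonneg (by positivity) (tilt_pos _ _ _ _).le
  refine ⟨_, fun T => B.total_play_le_of_geometric_pulls ε hao hq0.le hq1 hu0 ?_ (fun h => ?_) T⟩
  · intro n s
    have h1 := trial_tilt_le hp0 hp1 hr.le (by linarith [B.mean_le_one o]) n s
    have e : trial p u n s = (q ^ (κ * (n + 1)))⁻¹ * (q ^ κ)⁻¹ * trial p (tilt p (1 - ε)) n s := by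
      simp only [trial, hu]
      rw [show κ * (n + 1 + 1) = κ * (n + 1) + κ by ring, pow_add, mul_inv]
      ring
    rw [e, mul_assoc]
    simp only [hu]
    refine mul_le_mul_of_nonneg_left ?_ (by positivity)
    rw [inv_mul_le_iff₀ (by positivity)]
    exact h1.trans (mul_le_mul_of_nonneg_right hqκ (tilt_pos _ _ _ _).le)
  · split_ifs with hc
    · have h1 := one_le_tilt_of_le ho.le (successes_le_of_empMean_le hc.1)
      have h2 : q ^ (κ * (pulls h o + 1)) ≤ q ^ pulls h a :=
        pow_le_pow_of_le_one hq0.le hq1.le hc.2.le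
      have h3 : 1 ≤ q ^ pulls h a * (q ^ (κ * (pulls h o + 1)))⁻¹ := by
        rw [← div_eq_mul_inv, one_le_div (by positivity)]; exact h2
      simp only [hu]
      rw [← mul_assoc]
      exact one_le_mul_of_one_le_of_one_le h3 h1
    · exact mul_nonneg (by positivity) (hu0 _ _)

/-- If the optimal mean exceeds `1 - ε`, then the arms with gap greater than `ε` are played
a bounded number of times. -/
lemma exists_total_play_le (B : Bandit K) {ε : ℝ} (hε0 : 0 ≤ ε) (hε1 : ε < 1)
    (hopt : 1 - ε < B.optMean) {a : Fin K} (ha : ε < B.gap a) :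
    ∃ M : ℝ, ∀ T, B.total ε T (fun h => playProb ε h a) ≤ M := by
  classical
  have hr : 0 < 1 - ε := by linarith
  obtain ⟨o, ho⟩ := B.exists_mean_eq_optMean
  have hao : a ≠ o := by
    rintro rfl
    rw [gap, ho, sub_self] at ha
    linarith
  have hm0 := B.mean_nonneg a
  have hopt1 := B.optMean_le_one
  obtain ⟨y, hy1, hy2⟩ := exists_between (B.mean_lt_of_lt_gap hε0 ha)
  obtain ⟨z, hz1, hz2⟩ := exists_between hy1
  have hz0 : 0 < z := hm0.trans_lt hz1
  have hy0 : 0 < y := hz0.trans hz2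
  have hyε : y < 1 - ε := hy2.trans_le (mul_le_of_le_one_left hr.le hopt1)
  obtain ⟨κ, C, hC0, hC⟩ := exists_posterior_dominated K hε1 hz0 hz2 hyε
  obtain ⟨M₁, hM₁⟩ := B.exists_total_overestimated_le ε a hz1 (by linarith)
  obtain ⟨M₂, hM₂⟩ := B.exists_total_underestimated_le hε1 hao (ho ▸ hopt) κ
  obtain ⟨M₃, hM₃⟩ := B.exists_total_lowOdds_le hε0 hε1 o hy0
    (by rw [ho, div_lt_iff₀ hr]; exact hy2)
  have hCK : 0 ≤ 2 * C * K := by positivity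
  have hM₄ := fun T => B.total_geometric_le ε o hCK (show (0 : ℝ) ≤ 1 / 2 by norm_num)
    (by norm_num) T
  refine ⟨_, fun T => le_trans ?_
    (add_le_add (add_le_add (hM₁ T) (hM₂ T)) (add_le_add (hM₃ T) (hM₄ T)))⟩
  rw [← total_add, ← total_add, ← total_add]
  refine B.total_mono ε T fun h => ?_
  have hπa := playProb_nonneg ε h a
  have hπo := playProb_nonneg ε h o
  have hlo := lowOdds_nonneg (ε := ε) y h o
  have hgeo : 0 ≤ playProb ε h o * (2 * C * K * (1 / 2) ^ pulls h o) :=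
    mul_nonneg hπo (by positivity)
  have hlo' : 0 ≤ playProb ε h o * lowOdds ε y h o := mul_nonneg hπo hlo
  have hi2 : 0 ≤ playProb ε h a * (if empMean h o ≤ 1 - ε ∧
      pulls h a < κ * (pulls h o + 1) then (1 : ℝ) else 0) :=
    mul_nonneg hπa (by split_ifs <;> norm_num)
  by_cases hc1 : z * pulls h a < successes h a
  · rw [if_pos hc1, mul_one]
    linarith
  rw [if_neg hc1, mul_zero, zero_add]
  rw [not_lt] at hc1
  rcases le_or_gt (empMean h o) (1 - ε) with hh | hh
  · by_cases hc2 : pulls h a < κ * (pulls h o + 1)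
    · rw [if_pos ⟨hh, hc2⟩, mul_one]
      linarith
    · rw [if_neg (fun hc => hc2 hc.2), mul_zero, zero_add]
      obtain ⟨h1, h2⟩ := hC h a o hc1 hh (not_lt.1 hc2)
      have h3 := playProb_le_of_dominated ε (by positivity) h hao
        (posterior_real_Ioi_pos hε1 h o hy0.le hyε) h1 h2
      linarith
  -- Here the index of `o` exceeds `1 - ε` while that of `a` almost surely does not, so `a` is
  -- played with probability zero.
  · have hha : empMean h a ≤ 1 - ε := (empMean_le_of_successes_le hz0.le hc1).trans (by linarith)
    have hp := posterior_real_Ioi_of_lt h o hh (le_refl (1 - ε))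
    have h3 := playProb_le_add_tail ε (a := a) h (hp ▸ one_pos)
    rw [lowOdds_of_lt h o hh le_rfl, posterior_real_Ioi hε1 h a hha hr.le le_rfl, div_self hr.ne',
      binCDF_one (scaledSuccesses_le_pulls h a hha)] at h3
    linarith

/-- Plays of arm `a` while the optimal arm is underestimated, although it has been played at
least `m` times. -/
lemma total_underestimated_le (B : Bandit K) (ε : ℝ) {a o : Fin K} (hao : a ≠ o) {w L : ℝ}
    (hw0 : 0 ≤ w) (hw : w < B.mean o) (hL : 0 ≤ L) (m T : ℕ) :
    B.total ε T (fun h => playProb ε h a * (open Classical in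
      if (pulls h a : ℝ) < L ∧ m ≤ pulls h o ∧ (successes h o : ℝ) ≤ w * pulls h o
        then 1 else 0)) ≤ (L + 1) * rate (B.mean o) w ^ m := by
  classical
  set p := B.mean o with hp
  have hp0 := B.mean_nonneg o
  have hp1 := B.mean_le_one o
  have hρ0 := rate_pos p w
  have hρ1 := rate_lt_one hw.ne'
  -- The decay of the first `m` plays of `o` is credited in advance. Truncated subtraction turns the
  -- credit off afterwards, when the weight alone is a supermartingale.
  set u : ℕ → ℕ → ℝ := fun n s => rate p w ^ (m - n) * tilt p w n s with hu
  have hu0 : ∀ n s, 0 ≤ u n s := fun n s => mul_nonneg (by positivity) (tilt_pos _ _ _ _).le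
  have key := B.total_play_le_of_pulls_lt ε hao (u := u) (L := L) (c := fun h =>
    if (pulls h a : ℝ) < L ∧ m ≤ pulls h o ∧ (successes h o : ℝ) ≤ w * pulls h o
        then 1 else 0) hL hu0 (fun n s => ?_) (fun h hLa => ?_) (fun h hLa => ?_) T
  · refine key.trans (le_of_eq ?_)
    simp only [hu, tilt_zero, Nat.sub_zero, mul_one]
  · have h1 := trial_tilt_le hp0 hp1 hw0 (by linarith [B.mean_le_one o]) n s
    have e : trial p u n s = rate p w ^ (m - (n + 1)) * trial p (tilt p w) n s := by
      simp only [trial, hu]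
      ring
    rw [e]
    have ht := tilt_pos p w n s
    refine (mul_le_mul_of_nonneg_left h1 (by positivity)).trans ?_
    rw [← mul_assoc, ← pow_succ]
    exact mul_le_mul_of_nonneg_right (pow_le_pow_of_le_one hρ0.le hρ1.le (by omega)) ht.le
  · split_ifs with hc
    · simp only [hu]
      rw [Nat.sub_eq_zero_of_le hc.2.1, pow_zero, one_mul]
      exact one_le_tilt_of_le hw.le hc.2.2
    · exact hu0 _ _
  · rw [if_neg (fun hc => hLa.not_gt hc.1)]

lemma total_pulls_lt_le (B : Bandit K) (ε : ℝ) {a o : Fin K} (hao : a ≠ o) {L : ℝ}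
    (hL : 0 ≤ L) (T : ℕ) :
    B.total ε T (fun h => playProb ε h a * (open Classical in
      if (pulls h a : ℝ) < L then 1 else 0)) ≤ L + 1 := by
  classical
  have key := B.total_play_le_of_pulls_lt ε hao (u := fun _ _ => 1) (L := L)
    (c := fun h => if (pulls h a : ℝ) < L then 1 else 0) hL (fun _ _ => zero_le_one)
    (fun n s => le_of_eq (by rw [trial]; ring)) (fun h hLa => ?_) (fun h hLa => ?_) T
  · simpa using key
  · rw [if_pos hLa]
  · rw [if_neg hLa.not_gt]

/-- The logarithmic bound on the number of plays of a bad arm. -/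
lemma eventually_total_play_le (B : Bandit K) {ε : ℝ} (hε0 : 0 ≤ ε) (hε1 : ε < 1)
    (hopt : B.optMean ≤ 1 - ε) {a : Fin K} (ha : ε < B.gap a) {z y : ℝ} (hz : B.mean a < z)
    (hz' : z < B.optMean * (1 - ε)) (hzy : z < y) (hy : y < B.optMean) {η : ℝ} (hη : 0 < η) :
    ∀ᶠ T : ℕ in atTop, B.total ε T (fun h => playProb ε h a)
      ≤ (1 / klReal (z / (1 - ε)) (y / (1 - ε)) + η) * Real.log T := by
  classical
  have hr : 0 < 1 - ε := by linarith
  obtain ⟨o, ho⟩ := B.exists_mean_eq_optMean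
  have hao : a ≠ o := by
    rintro rfl
    rw [gap, ho, sub_self] at ha
    linarith
  have hm0 := B.mean_nonneg a
  have hopt1 := B.optMean_le_one
  have hz0 : 0 < z := hm0.trans_lt hz
  -- Two thresholds: for `x < (1 - ε) * μ*` the loss due to `o` is bounded, while `y` close to `μ*`
  -- gives the sharp constant but needs the empirical mean of `o` above `w`.
  obtain ⟨x, hx1, hx2⟩ := exists_between hz'
  obtain ⟨w, hw1, hw2⟩ := exists_between hy
  have hx0 : 0 < x := hz0.trans hx1
  have hy0 : 0 < y := hz0.trans hzy
  have hxε : x < 1 - ε := hx2.trans_le (mul_le_of_le_one_left hr.le hopt1)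
  have hyε : y < 1 - ε := hy.trans_le hopt
  have hklpos : ∀ v, z < v → v < 1 - ε → 0 < klReal (z / (1 - ε)) (v / (1 - ε)) := by
    intro v hv hvε
    have h1 : z / (1 - ε) < v / (1 - ε) := div_lt_div_of_pos_right hv hr
    have h2 : v / (1 - ε) < 1 := (div_lt_one hr).2 hvε
    exact klReal_pos (div_pos hz0 hr) (h1.trans h2) (div_pos (hz0.trans hv) hr) h2 h1.ne
  set D := klReal (z / (1 - ε)) (y / (1 - ε)) with hD
  set D' := klReal (z / (1 - ε)) (x / (1 - ε)) with hD'
  have hD0 : 0 < D := hklpos y hzy hyε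
  have hD'0 : 0 < D' := hklpos x hx1 hxε
  have hρ0 := rate_pos (B.mean o) w
  have hρ1 : rate (B.mean o) w < 1 := rate_lt_one (by rw [ho]; exact hw2.ne')
  -- Makes the cost of underestimating `o` during the first `ln T / D'` plays of `a` at most `η / 2
  -- * ln T`, up to a constant.
  obtain ⟨m, hm⟩ := exists_pow_lt_of_lt_one (show 0 < η / 2 * D' by positivity) hρ1
  obtain ⟨M₁, hM₁⟩ := B.exists_total_overestimated_le ε a hz (by linarith)
  obtain ⟨M₃, hM₃⟩ := B.exists_total_lowOdds_le hε0 hε1 o hx0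
    (by rw [ho, div_lt_iff₀ hr]; exact hx2)
  obtain ⟨C, ρ, hC0, hρ'0, hρ'1, hC⟩ := exists_lowOdds_le_of_not_underestimated K hε1
    hy0.le hw1 (hw2.le.trans hopt) m
  have hbound : ∀ T : ℕ, 1 ≤ T → B.total ε T (fun h => playProb ε h a)
      ≤ (M₁ + (Real.log T / D + 1)) + (M₃ + 1)
        + ((Real.log T / D' + 1) * rate (B.mean o) w ^ m + C / (1 - ρ)) := by
    intro T hT
    have hT0 : (0 : ℝ) < T := by exact_mod_cast hT
    have hlog : 0 ≤ Real.log T := Real.log_nonneg (by exact_mod_cast hT)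
    set L := Real.log T / D with hL
    set L' := Real.log T / D' with hL'
    have hL0 : 0 ≤ L := by positivity
    have hL'0 : 0 ≤ L' := by positivity
    have hM₂ := B.total_pulls_lt_le ε hao hL0 T
    have hM₄ : B.total ε T (fun _ => 1 / (T : ℝ)) ≤ 1 := by
      rw [total_const, mul_one_div, div_self hT0.ne']
    have hM₅ := B.total_underestimated_le ε hao (hy0.le.trans hw1.le) (ho ▸ hw2) hL'0 m T
    have hM₆ := B.total_geometric_le ε o hC0 hρ'0 hρ'1 T
    refine le_trans ?_ (add_le_add (add_le_add (add_le_add (hM₁ T) hM₂)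
      (add_le_add (hM₃ T) hM₄)) (add_le_add hM₅ hM₆))
    simp only [← total_add]
    refine B.total_mono ε T fun h => ?_
    have hπa := playProb_nonneg ε h a
    have hπo := playProb_nonneg ε h o
    have hlo : 0 ≤ playProb ε h o * lowOdds ε x h o := mul_nonneg hπo (lowOdds_nonneg _ _ _)
    have hgeo : 0 ≤ playProb ε h o * (C * ρ ^ pulls h o) := mul_nonneg hπo (by positivity)
    have hT1 : 0 ≤ 1 / (T : ℝ) := by positivity
    have hi2 : 0 ≤ playProb ε h a * (if (pulls h a : ℝ) < L then (1 : ℝ) else 0) :=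
      mul_nonneg hπa (by split_ifs <;> norm_num)
    have hi5 : 0 ≤ playProb ε h a * (if (pulls h a : ℝ) < L' ∧ m ≤ pulls h o ∧
        (successes h o : ℝ) ≤ w * pulls h o then (1 : ℝ) else 0) :=
      mul_nonneg hπa (by split_ifs <;> norm_num)
    by_cases hc1 : z * pulls h a < successes h a
    · rw [if_pos hc1, mul_one]
      linarith
    rw [if_neg hc1, mul_zero, zero_add]
    rw [not_lt] at hc1
    -- Enough plays push the tail of `a` below `1 / T`, which costs at most one play in `T` rounds.
    have htail : ∀ v, z < v → v < 1 - ε →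
        Real.log T / klReal (z / (1 - ε)) (v / (1 - ε)) ≤ pulls h a →
        playProb ε h a ≤ lowOdds ε v h o * playProb ε h o + 1 / T := by
      intro v hv hvε hLv
      refine (playProb_le_add_tail ε (a := a) h
        (posterior_real_Ioi_pos hε1 h o (hz0.trans hv).le hvε)).trans ?_
      gcongr
      refine (posterior_real_Ioi_le_exp hε1 h a hz0 hv hvε hc1).trans ?_
      rw [div_le_iff₀ (hklpos v hv hvε)] at hLv
      refine (Real.exp_le_exp.2 (neg_le_neg hLv)).trans (le_of_eq ?_)
      rw [Real.exp_neg, Real.exp_log hT0, one_div]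
    by_cases hc2 : (pulls h a : ℝ) < L
    · rw [if_pos hc2, mul_one]
      linarith
    rw [if_neg hc2, mul_zero, zero_add]
    rw [not_lt] at hc2
    rcases lt_or_ge (pulls h a : ℝ) L' with hc3 | hc3
    · by_cases hc4 : m ≤ pulls h o ∧ (successes h o : ℝ) ≤ w * pulls h o
      · rw [if_pos ⟨hc3, hc4⟩, mul_one]
        linarith
      · rw [if_neg (fun hc => hc4 hc.2), mul_zero, zero_add]
        have h1 := htail y hzy hyε hc2
        have h2 := mul_le_mul_of_nonneg_right (hC h o hc4) hπo
        linarith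
    · have h1 := htail x hx1 hxε hc3
      linarith
  set A := M₁ + 1 + (M₃ + 1) + (rate (B.mean o) w ^ m + C / (1 - ρ)) with hA
  have hlim : Tendsto (fun T : ℕ => Real.log (T : ℝ)) atTop atTop :=
    Real.tendsto_log_atTop.comp tendsto_natCast_atTop_atTop
  filter_upwards [eventually_ge_atTop 1, hlim.eventually_ge_atTop (A / (η / 2))] with T hT hTA
  refine (hbound T hT).trans ?_
  have hlog : 0 ≤ Real.log T := Real.log_nonneg (by exact_mod_cast hT)
  rw [div_le_iff₀ (by positivity)] at hTA
  have h1 : Real.log T / D' * rate (B.mean o) w ^ m ≤ η / 2 * Real.log T := by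
    rw [div_mul_eq_mul_div, div_le_iff₀ hD'0]
    nlinarith
  have h2 : (1 / D + η) * Real.log T = Real.log T / D + η / 2 * Real.log T
      + Real.log T * (η / 2) := by ring
  rw [h2]
  nlinarith

end Bandit

/-! ### Continuity of the relative entropy -/

lemma klReal_eq (p : ℝ) {q : ℝ} (hq0 : 0 < q) (hq1 : q < 1) :
    klReal p q = -Real.binEntropy p - p * Real.log q - (1 - p) * Real.log (1 - q) := by
  have key : ∀ x y : ℝ, y ≠ 0 → x * Real.log (x / y) = x * Real.log x - x * Real.log y := by
    intro x y hy
    rcases eq_or_ne x 0 with rfl | hx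
    · simp
    · rw [Real.log_div hx hy]; ring
  rw [klReal, key _ _ hq0.ne', key _ _ (sub_pos.2 hq1).ne', Real.binEntropy, Real.log_inv,
    Real.log_inv]
  ring

lemma continuous_klReal_left {q : ℝ} (hq0 : 0 < q) (hq1 : q < 1) :
    Continuous (fun p => klReal p q) := by
  have : (fun p => klReal p q)
      = fun p => -Real.binEntropy p - p * Real.log q - (1 - p) * Real.log (1 - q) :=
    funext fun p => klReal_eq p hq0 hq1
  rw [this]
  have := Real.binEntropy_continuous
  fun_prop

lemma continuousAt_klReal_right (p : ℝ) {q : ℝ} (hq0 : 0 < q) (hq1 : q < 1) :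
    ContinuousAt (fun q => klReal p q) q := by
  have h : (fun q => klReal p q) =ᶠ[nhds q]
      fun q => -Real.binEntropy p - p * Real.log q - (1 - p) * Real.log (1 - q) := by
    filter_upwards [Ioo_mem_nhds hq0 hq1] with x hx using klReal_eq p hx.1 hx.2
  refine ContinuousAt.congr ?_ h.symm
  have h1 : ContinuousAt Real.log q := Real.continuousAt_log hq0.ne'
  have h2 : ContinuousAt (fun x => Real.log (1 - x)) q :=
    ContinuousAt.log (by fun_prop) (sub_pos.2 hq1).ne'
  exact (continuousAt_const.sub (continuousAt_const.mul h1)).sub (continuousAt_const.mul h2)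

lemma bernKL_of_mem {p q : ℝ} (hq0 : 0 < q) (hq1 : q < 1) :
    bernKL p q = ENNReal.ofReal (klReal p q) := by
  rw [bernKL, if_neg, klReal]
  rintro (h | h)
  · exact hq1.not_ge h.2
  · exact hq0.ne' h.2

lemma tendsto_klReal_one {p : ℝ} (hp0 : 0 ≤ p) (hp1 : p < 1) :
    Tendsto (fun q => klReal p q) (nhdsWithin 1 (Set.Iio 1)) atTop := by
  have h1 : Tendsto (fun q : ℝ => 1 - q) (nhdsWithin 1 (Set.Iio 1)) (nhdsWithin 0 (Set.Ioi 0)) := by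
    refine tendsto_nhdsWithin_iff.2 ⟨?_, ?_⟩
    · have : Tendsto (fun q : ℝ => 1 - q) (nhds 1) (nhds (1 - 1)) :=
        (by fun_prop : Continuous fun q : ℝ => 1 - q).tendsto 1
      rw [sub_self] at this
      exact this.mono_left nhdsWithin_le_nhds
    · filter_upwards [self_mem_nhdsWithin] with q hq
      exact sub_pos.2 (Set.mem_Iio.1 hq)
  have h2 := Real.tendsto_log_nhdsGT_zero.comp h1
  have h3 : Tendsto (fun q : ℝ => -Real.binEntropy p + (1 - p) * -Real.log (1 - q))
      (nhdsWithin 1 (Set.Iio 1)) atTop :=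
    tendsto_atTop_add_const_left _ _
      ((tendsto_neg_atBot_atTop.comp h2).const_mul_atTop (sub_pos.2 hp1))
  refine tendsto_atTop_mono' _ ?_ h3
  filter_upwards [Ioo_mem_nhdsLT (show (0 : ℝ) < 1 by norm_num)] with q hq
  rw [klReal_eq p hq.1 hq.2]
  have := mul_nonpos_of_nonneg_of_nonpos hp0 (Real.log_nonpos hq.1.le hq.2.le)
  linarith

/-- Lower semicontinuity in two moves: first lower `q`, where an infinite value at `q = 1` is
reached as a limit, then raise `p` with the interior second argument fixed. -/
lemma exists_lt_klReal {p q v c : ℝ} (hp0 : 0 ≤ p) (hpq : p < q) (hq1 : q ≤ 1) (hpv : p < v)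
    (hc : ENNReal.ofReal c < bernKL p q) :
    ∃ z y, p < z ∧ z < v ∧ z < y ∧ y < q ∧ c < klReal z y := by
  have hq0 : 0 < q := hp0.trans_lt hpq
  have hy : ∃ y, p < y ∧ y < q ∧ c < klReal p y := by
    rcases hq1.eq_or_lt with rfl | hq1
    · have h := ((tendsto_klReal_one hp0 hpq).eventually_gt_atTop c).and (Ioo_mem_nhdsLT hpq)
      obtain ⟨y, h1, h2⟩ := h.exists
      exact ⟨y, h2.1, h2.2, h1⟩
    · rw [bernKL_of_mem hq0 hq1] at hc
      have hc' : c < klReal p q := by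
        by_contra hle
        exact hc.not_ge (ENNReal.ofReal_le_ofReal (not_lt.1 hle))
      have h := (((continuousAt_klReal_right p hq0 hq1).eventually
        (lt_mem_nhds hc')).filter_mono (nhdsWithin_le_nhds (s := Set.Iio q))).and
          (Ioo_mem_nhdsLT hpq)
      obtain ⟨y, h1, h2⟩ := h.exists
      exact ⟨y, h2.1, h2.2, h1⟩
  obtain ⟨y, hpy, hyq, hcy⟩ := hy
  have h := (((continuous_klReal_left (hp0.trans_lt hpy) (hyq.trans_le hq1)).continuousAt.eventually
    (lt_mem_nhds hcy)).filter_mono (nhdsWithin_le_nhds (s := Set.Ioi p))).and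
      (Ioo_mem_nhdsGT (lt_min hpv hpy))
  obtain ⟨z, h1, h2⟩ := h.exists
  exact ⟨z, y, h2.1, h2.2.trans_le (min_le_left _ _), h2.2.trans_le (min_le_right _ _), hyq, h1⟩

/-! ### The asymptotic upper bound -/

namespace Bandit

variable {K : ℕ} [NeZero K]

lemma limsup_total_play_le (B : Bandit K) {ε : ℝ} (hε0 : 0 ≤ ε) (hε1 : ε < 1) {a : Fin K}
    (ha : ε < B.gap a) :
    limsup (fun T : ℕ => ENNReal.ofReal (B.total ε T (fun h => playProb ε h a) / Real.log T)) atTop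
      ≤ (bernKL (B.mean a / (1 - ε)) (B.optMean / (1 - ε)))⁻¹ := by
  have hr : 0 < 1 - ε := by linarith
  have hlim : Tendsto (fun T : ℕ => Real.log (T : ℝ)) atTop atTop :=
    Real.tendsto_log_atTop.comp tendsto_natCast_atTop_atTop
  rcases le_or_gt B.optMean (1 - ε) with hopt | hopt
  · rw [ENNReal.le_inv_iff_le_inv]
    refine le_of_forall_lt fun c hc => ?_
    obtain ⟨c', hcc', hc'⟩ := exists_between hc
    refine hcc'.trans_le ?_
    rw [ENNReal.le_inv_iff_le_inv]
    lift c' to ℝ≥0 using hc'.ne_top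
    have hc'0 : 0 < (c' : ℝ) := by
      have : (0 : ℝ≥0∞) < c' := zero_le.trans_lt hcc'
      exact_mod_cast this
    have hmv : B.mean a / (1 - ε) < B.optMean := by
      rw [div_lt_iff₀ hr]; exact B.mean_lt_of_lt_gap hε0 ha
    obtain ⟨z, y, hz, hzv, hzy, hyq, hcz⟩ := exists_lt_klReal
      (div_nonneg (B.mean_nonneg a) hr.le)
      (div_lt_div_of_pos_right (by unfold gap at ha; linarith) hr) ((div_le_one hr).2 hopt) hmv
      (c := c') (by rwa [ENNReal.ofReal_coe_nnreal])
    refine ENNReal.le_of_forall_pos_le_add fun η hη _ => ?_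
    refine limsup_le_of_le (by isBoundedDefault) ?_
    have hev := B.eventually_total_play_le hε0 hε1 hopt ha (z := z * (1 - ε)) (y := y * (1 - ε))
      ((div_lt_iff₀ hr).1 hz) (by gcongr) (by gcongr) ((lt_div_iff₀ hr).1 hyq)
      (NNReal.coe_pos.2 hη)
    filter_upwards [hev, hlim.eventually_gt_atTop 0] with T hT hlog
    rw [mul_div_cancel_right₀ _ hr.ne', mul_div_cancel_right₀ _ hr.ne', ← div_le_iff₀ hlog] at hT
    have h1 : B.total ε T (fun h => playProb ε h a) / Real.log T ≤ (c' : ℝ)⁻¹ + η := by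
      refine hT.trans (add_le_add ?_ le_rfl)
      rw [one_div]
      exact inv_anti₀ hc'0 hcz.le
    refine (ENNReal.ofReal_le_ofReal h1).trans (le_of_eq ?_)
    rw [ENNReal.ofReal_add (by positivity) (NNReal.coe_nonneg η), ENNReal.ofReal_inv_of_pos hc'0,
      ENNReal.ofReal_coe_nnreal, ENNReal.ofReal_coe_nnreal]
  -- The plays are bounded, so the limsup is zero and the right-hand side does not matter.
  · obtain ⟨M, hM⟩ := B.exists_total_play_le hε0 hε1 hopt ha
    have h1 : Tendsto (fun T : ℕ => ENNReal.ofReal (M / Real.log T)) atTop (nhds 0) := by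
      have := ENNReal.tendsto_ofReal (hlim.const_div_atTop M)
      rwa [ENNReal.ofReal_zero] at this
    refine (limsup_le_limsup ?_).trans (h1.limsup_eq.le.trans zero_le)
    filter_upwards [hlim.eventually_gt_atTop 0] with T hlog
    refine ENNReal.ofReal_le_ofReal ?_
    gcongr
    exact hM T

lemma limsup_add_le (u v : ℕ → ℝ≥0∞) :
    limsup (fun T => u T + v T) atTop ≤ limsup u atTop + limsup v atTop := by
  refine ENNReal.le_of_forall_pos_le_add fun η hη hlt => ?_
  have hη' : (η / 2 : ℝ≥0∞) ≠ 0 := by simpa using hη.ne'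
  obtain ⟨hu, hv⟩ := ENNReal.add_lt_top.1 hlt
  refine limsup_le_of_le (by isBoundedDefault) ?_
  filter_upwards [eventually_lt_of_limsup_lt (ENNReal.lt_add_right hu.ne hη'),
    eventually_lt_of_limsup_lt (ENNReal.lt_add_right hv.ne hη')] with T h1 h2
  refine (add_le_add h1.le h2.le).trans (le_of_eq ?_)
  rw [add_add_add_comm, ENNReal.add_halves]

lemma limsup_finset_sum_le {ι : Type*} (s : Finset ι) (u : ι → ℕ → ℝ≥0∞) :
    limsup (fun T => ∑ i ∈ s, u i T) atTop ≤ ∑ i ∈ s, limsup (u i) atTop := by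
  classical
  induction s using Finset.induction_on with
  | empty => simp
  | insert i s hi ih =>
    simp only [Finset.sum_insert hi]
    exact (limsup_add_le _ _).trans (add_le_add le_rfl ih)

lemma eps_lt_one_of_lt_gap (B : Bandit K) {ε : ℝ} {a : Fin K} (ha : ε < B.gap a) : ε < 1 :=
  ha.trans_le (B.gap_le_one a)

open Classical in
lemma lenientRegret_eq_sum_filter (B : Bandit K) {ε : ℝ} {f : ℝ → ℝ} (hf : IsGapFunction ε f)
    (T : ℕ) : B.lenientRegret ε f T
      = ∑ a with ε < B.gap a, f (B.gap a) * B.total ε T (fun h => playProb ε h a) := by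
  rw [B.lenientRegret_eq ε (hf.nonneg B), Finset.sum_filter]
  refine Finset.sum_congr rfl fun a _ => ?_
  split_ifs with h
  · rfl
  · rw [hf.eq_zero _ ⟨B.gap_nonneg a, not_lt.1 h⟩, zero_mul]

theorem limsup_lenientRegret_le (B : Bandit K) {ε : ℝ} {f : ℝ → ℝ} (hf : IsGapFunction ε f) :
    limsup (fun T : ℕ => ENNReal.ofReal (B.lenientRegret ε f T / Real.log T)) atTop ≤
      B.gapSum ε f (fun a => bernKL (B.mean a / (1 - ε)) (B.optMean / (1 - ε))) := by
  classical
  have h1 : ∀ T : ℕ, ENNReal.ofReal (B.lenientRegret ε f T / Real.log T)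
      = ∑ a with ε < B.gap a, ENNReal.ofReal (f (B.gap a))
        * ENNReal.ofReal (B.total ε T (fun h => playProb ε h a) / Real.log T) := by
    intro T
    rw [B.lenientRegret_eq_sum_filter hf, Finset.sum_div, ENNReal.ofReal_sum_of_nonneg]
    · refine Finset.sum_congr (by congr) fun a _ => ?_
      rw [← ENNReal.ofReal_mul (hf.nonneg B a), mul_div_assoc]
    · intro a _
      exact div_nonneg (mul_nonneg (hf.nonneg B a)
        (B.total_nonneg ε T fun h => playProb_nonneg ε h a)) (Real.log_natCast_nonneg T)
  simp only [h1]
  refine (limsup_finset_sum_le _ _).trans ?_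
  rw [gapSum]
  refine le_trans (Finset.sum_le_sum fun a ha => ?_) (le_of_eq (Finset.sum_congr (by congr)
    fun _ _ => rfl))
  have hgap : ε < B.gap a := (Finset.mem_filter.1 ha).2
  rw [ENNReal.limsup_const_mul_of_ne_top ENNReal.ofReal_ne_top, div_eq_mul_inv]
  gcongr
  exact B.limsup_total_play_le hf.eps_mem.1 (B.eps_lt_one_of_lt_gap hgap) hgap

/-! ### Bounded regret -/

theorem exists_lenientRegret_le (B : Bandit K) {ε : ℝ} (hopt : 1 - ε < B.optMean) :
    ∃ M : ℝ, ∀ (B' : Bandit K) (f : ℝ → ℝ), (∀ a, B'.mean a = B.mean a) → IsGapFunction ε f →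
      ∀ T : ℕ, B'.lenientRegret ε f T ≤ M * ⨆ a, f (B'.gap a) := by
  classical
  by_cases hε : 0 ≤ ε
  · have hbd : ∀ a, ∃ M : ℝ, 0 ≤ M ∧
        (ε < B.gap a → ∀ T, B.total ε T (fun h => playProb ε h a) ≤ M) := by
      intro a
      by_cases ha : ε < B.gap a
      · obtain ⟨M, hM⟩ := B.exists_total_play_le hε (B.eps_lt_one_of_lt_gap ha) hopt ha
        exact ⟨max M 0, le_max_right _ _, fun _ T => (hM T).trans (le_max_left _ _)⟩
      · exact ⟨0, le_rfl, fun h => absurd h ha⟩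
    choose M hM0 hM using hbd
    refine ⟨∑ a, M a, fun B' f hB' hf T => ?_⟩
    have hopt' : B'.optMean = B.optMean := by simp only [optMean, hB']
    have hgap : ∀ a, B'.gap a = B.gap a := fun a => by rw [gap, gap, hopt', hB']
    have hsup : ∀ a, f (B'.gap a) ≤ ⨆ a, f (B'.gap a) := fun a =>
      le_ciSup (Set.finite_range fun a => f (B'.gap a)).bddAbove a
    rw [B'.lenientRegret_eq_sum_filter hf, Finset.sum_filter, Finset.sum_mul]
    refine Finset.sum_le_sum fun a _ => ?_
    have h0 := hf.nonneg B' a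
    split_ifs with ha
    · rw [hgap] at ha
      rw [B'.total_congr B ε hB', mul_comm]
      exact mul_le_mul (hM a ha T) (hsup a) h0 (hM0 a)
    · exact mul_nonneg (hM0 a) (h0.trans (hsup a))
  · exact ⟨0, fun B' f _ hf => absurd hf.eps_mem.1 hε⟩

end Bandit

/-! ### The order of magnitude of the bound -/

lemma hasDerivAt_klReal (p : ℝ) {q : ℝ} (hq0 : 0 < q) (hq1 : q < 1) :
    HasDerivAt (fun q => klReal p q) ((q - p) / (q * (1 - q))) q := by
  have h : (fun q => klReal p q) =ᶠ[nhds q]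
      fun q => -Real.binEntropy p - p * Real.log q - (1 - p) * Real.log (1 - q) := by
    filter_upwards [Ioo_mem_nhds hq0 hq1] with x hx using klReal_eq p hx.1 hx.2
  have hq1' := sub_pos.2 hq1
  refine HasDerivAt.congr_of_eventuallyEq ?_ h
  have h1 := (Real.hasDerivAt_log hq0.ne').const_mul p
  have h2 := (((hasDerivAt_id q).const_sub 1).log hq1'.ne').const_mul (1 - p)
  refine (((hasDerivAt_const q (-Real.binEntropy p)).sub h1).sub h2).congr_deriv ?_
  simp only [id]
  field_simp
  ring

lemma klReal_self {p : ℝ} : klReal p p = 0 := by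
  have h : ∀ x : ℝ, x * Real.log (x / x) = 0 := by
    intro x
    rcases eq_or_ne x 0 with rfl | hx
    · simp
    · rw [div_self hx, Real.log_one, mul_zero]
  rw [klReal, h, h, add_zero]

/-- At `q = 0` the logarithm of `q` is singular, but then `p = 0` and its coefficient vanishes. -/
lemma continuousAt_klReal_self {p q : ℝ} (hp0 : 0 ≤ p) (hpq : p ≤ q) (hq1 : q < 1) :
    ContinuousAt (fun q => klReal p q) q := by
  rcases (hp0.trans hpq).eq_or_lt with hq0 | hq0
  · obtain rfl : q = 0 := hq0.symm
    obtain rfl : p = 0 := le_antisymm hpq hp0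
    simp only [klReal, zero_mul, zero_add]
    refine continuousAt_const.mul (ContinuousAt.log ?_ (by norm_num))
    exact ContinuousAt.div (by fun_prop) (by fun_prop) (by norm_num)
  · exact continuousAt_klReal_right p hq0 hq1

/-- Let `u` run from `p` to `q` and `x = p + σ * (u - p)` from `p` to `q + ε`. The two derivatives
in `u` are `(u - p) / (u * (1 - ε - u))` and `σ ^ 2 * (u - p) / (x * (1 - x))`. Since `u ≤ x ≤ u +
ε`, the second is at most `σ ^ 2` times the first, and `q - p > ε` gives `σ ≤ 2`. -/
lemma klReal_add_le_four_mul {p q ε : ℝ} (hp0 : 0 ≤ p) (hε0 : 0 ≤ ε) (hpq : p + ε < q)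
    (hq : q < 1 - ε) :
    klReal p (q + ε) ≤ 4 * klReal (p / (1 - ε)) (q / (1 - ε)) := by
  have hr : 0 < 1 - ε := by linarith
  have hqp : 0 < q - p := by linarith
  set σ := (q + ε - p) / (q - p) with hσ
  have hσ1 : 1 ≤ σ := by rw [hσ, one_le_div hqp]; linarith
  have hσ2 : σ ≤ 2 := by rw [hσ, div_le_iff₀ hqp]; linarith
  have hσq : σ * (q - p) = q + ε - p := by rw [hσ]; field_simp
  set G : ℝ → ℝ := fun u => σ ^ 2 * klReal (p / (1 - ε)) (u / (1 - ε))
    - klReal p (p + σ * (u - p)) with hG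
  have hmono : MonotoneOn G (Set.Icc p q) := by
    have hx1 : ∀ u, p ≤ u → u ≤ q → p + σ * (u - p) ≤ u + ε := by
      intro u h1 h2
      have : (σ - 1) * (u - p) ≤ (σ - 1) * (q - p) :=
        mul_le_mul_of_nonneg_left (by linarith) (by linarith)
      nlinarith
    have hxu : ∀ u, p ≤ u → u ≤ p + σ * (u - p) := by
      intro u h1
      nlinarith
    have hcont : ContinuousOn G (Set.Icc p q) := by
      intro u hu
      refine ContinuousAt.continuousWithinAt ?_
      have h1 : u / (1 - ε) < 1 := (div_lt_one hr).2 (hu.2.trans_lt hq)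
      have h2 := continuousAt_klReal_self (div_nonneg hp0 hr.le)
        (div_le_div_of_nonneg_right hu.1 hr.le) h1
      have h3 := continuousAt_klReal_self hp0 (hu.1.trans (hxu u hu.1))
        ((hx1 u hu.1 hu.2).trans_lt (by linarith [hu.2]))
      have h4 : ContinuousAt (fun u : ℝ => klReal (p / (1 - ε)) (u / (1 - ε))) u :=
        ContinuousAt.comp (f := fun u : ℝ => u / (1 - ε)) h2 (by fun_prop)
      have h5 : ContinuousAt (fun u : ℝ => klReal p (p + σ * (u - p))) u :=
        ContinuousAt.comp (f := fun u : ℝ => p + σ * (u - p)) h3 (by fun_prop)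
      exact (continuousAt_const.mul h4).sub h5
    have hderiv : ∀ u ∈ interior (Set.Icc p q), HasDerivAt G
        (σ ^ 2 * ((u / (1 - ε) - p / (1 - ε)) / (u / (1 - ε) * (1 - u / (1 - ε))) * (1 / (1 - ε)))
          - (p + σ * (u - p) - p) / ((p + σ * (u - p)) * (1 - (p + σ * (u - p)))) * σ) u := by
      intro u hu
      rw [interior_Icc] at hu
      have hu0 : 0 < u := hp0.trans_lt hu.1
      have h1 : u / (1 - ε) < 1 := (div_lt_one hr).2 (hu.2.trans hq)
      have h2 := hasDerivAt_klReal (p / (1 - ε)) (div_pos hu0 hr) h1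
      have h3 := hasDerivAt_klReal p (hu0.trans_le (hxu u hu.1.le))
        ((hx1 u hu.1.le hu.2.le).trans_lt (by linarith [hu.2]))
      have h4 : HasDerivAt (fun u : ℝ => u / (1 - ε)) (1 / (1 - ε)) u :=
        (hasDerivAt_id u).div_const _
      have h5 : HasDerivAt (fun u : ℝ => p + σ * (u - p)) σ u := by
        have := (((hasDerivAt_id u).sub_const p).const_mul σ).const_add p
        simpa using this
      have h6 := HasDerivAt.comp (h := fun u : ℝ => u / (1 - ε)) u h2 h4
      have h7 := HasDerivAt.comp (h := fun u : ℝ => p + σ * (u - p)) u h3 h5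
      exact (h6.const_mul (σ ^ 2)).sub h7
    refine monotoneOn_of_deriv_nonneg (convex_Icc p q) hcont
      (fun u hu => (hderiv u hu).differentiableAt.differentiableWithinAt) (fun u hu => ?_)
    rw [(hderiv u hu).deriv, sub_nonneg]
    rw [interior_Icc] at hu
    have hu0 : 0 < u := hp0.trans_lt hu.1
    have hru : 0 < 1 - ε - u := by linarith [hu.2]
    have h1 := hx1 u hu.1.le hu.2.le
    have h2 := hxu u hu.1.le
    set x := p + σ * (u - p) with hx
    have e1 : σ ^ 2 * ((u / (1 - ε) - p / (1 - ε)) / (u / (1 - ε) * (1 - u / (1 - ε)))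
        * (1 / (1 - ε))) = σ ^ 2 * (u - p) / (u * (1 - ε - u)) := by
      have : 1 - u / (1 - ε) = (1 - ε - u) / (1 - ε) := by field_simp
      rw [this]
      field_simp
    have e2 : (x - p) / (x * (1 - x)) * σ = σ ^ 2 * (u - p) / (x * (1 - x)) := by
      rw [hx]; ring
    rw [e1, e2]
    have hup : 0 < u - p := sub_pos.2 hu.1
    refine div_le_div_of_nonneg_left (by positivity) (by positivity) ?_
    exact mul_le_mul h2 (by linarith) hru.le (by linarith)
  have h0 : G p = 0 := by
    simp only [hG, sub_self, mul_zero, add_zero, klReal_self]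
  have h1 : G p ≤ G q := hmono ⟨le_rfl, by linarith⟩ ⟨by linarith, le_rfl⟩ (by linarith)
  have h2 : p + σ * (q - p) = q + ε := by rw [hσq]; ring
  rw [h0] at h1
  simp only [hG, h2, sub_nonneg] at h1
  have hkl : 0 ≤ klReal (p / (1 - ε)) (q / (1 - ε)) := by
    rcases hp0.eq_or_lt with rfl | hp
    · rw [klReal]
      simp only [zero_div, zero_mul, zero_add, sub_zero, one_mul]
      refine Real.log_nonneg ?_
      have : q / (1 - ε) < 1 := (div_lt_one hr).2 hq
      have : 0 ≤ q / (1 - ε) := div_nonneg (by linarith) hr.le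
      rw [le_div_iff₀ (by linarith)]
      linarith
    · have hlt : p / (1 - ε) < q / (1 - ε) := div_lt_div_of_pos_right (by linarith) hr
      have hlt1 : q / (1 - ε) < 1 := (div_lt_one hr).2 hq
      exact (klReal_pos (div_pos hp hr) (hlt.trans hlt1) (div_pos (by linarith) hr) hlt1 hlt.ne).le
  refine h1.trans (mul_le_mul_of_nonneg_right ?_ hkl)
  nlinarith

lemma klDiv_bernoulliMeasure (p q : unitInterval) (hq0 : 0 < (q : ℝ)) (hq1 : (q : ℝ) < 1) :
    InformationTheory.klDiv (bernoulliMeasure (1 : ℝ) 0 p) (bernoulliMeasure (1 : ℝ) 0 q)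
      = ENNReal.ofReal (klReal p q) := by
  classical
  set g : ℝ → ℝ≥0∞ := fun x => if x = 1 then ENNReal.ofReal (p / q)
    else ENNReal.ofReal ((1 - p) / (1 - q)) with hg
  have hgm : Measurable g :=
    Measurable.ite (measurableSet_singleton 1) measurable_const measurable_const
  have hq1' : 0 < 1 - (q : ℝ) := sub_pos.2 hq1
  have hp0 : 0 ≤ (p : ℝ) := p.2.1
  have hp1 : 0 ≤ 1 - (p : ℝ) := sub_nonneg.2 p.2.2
  have hcoe : ∀ r : unitInterval, ((unitInterval.toNNReal r : ℝ≥0) : ℝ≥0∞) = ENNReal.ofReal r := by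
    intro r
    rw [← ENNReal.ofReal_coe_nnreal]
    rfl
  have hd : bernoulliMeasure (1 : ℝ) 0 p = (bernoulliMeasure (1 : ℝ) 0 q).withDensity g := by
    ext s hs
    have e1 : (q : ℝ) * (p / q) = p := by field_simp
    have e2 : (1 - q : ℝ) * ((1 - p) / (1 - q)) = 1 - p := by field_simp
    rw [withDensity_apply _ hs, ← lintegral_indicator hs, bernoulliMeasure_def,
      bernoulliMeasure_def, lintegral_add_measure, lintegral_smul_measure, lintegral_smul_measure,
      lintegral_dirac, lintegral_dirac]
    simp only [Measure.add_apply, Measure.smul_apply, Measure.dirac_apply' _ hs,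
      ENNReal.smul_def, smul_eq_mul, hcoe, unitInterval.coe_symm_eq]
    congr 1
    · by_cases h1 : (1 : ℝ) ∈ s
      · simp only [Set.indicator_of_mem h1, hg, if_true, Pi.one_apply, mul_one]
        rw [← ENNReal.ofReal_mul hq0.le, e1]
      · simp [Set.indicator_of_notMem h1]
    · by_cases h1 : (0 : ℝ) ∈ s
      · simp only [Set.indicator_of_mem h1, hg, zero_ne_one, if_false, Pi.one_apply, mul_one]
        rw [← ENNReal.ofReal_mul hq1'.le, e2]
      · simp [Set.indicator_of_notMem h1]
  have hac : bernoulliMeasure (1 : ℝ) 0 p ≪ bernoulliMeasure (1 : ℝ) 0 q := by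
    rw [hd]; exact withDensity_absolutelyContinuous _ _
  have hrn : (bernoulliMeasure (1 : ℝ) 0 p).rnDeriv (bernoulliMeasure (1 : ℝ) 0 q)
      =ᵐ[bernoulliMeasure (1 : ℝ) 0 q] g := by
    conv_lhs => rw [hd]
    exact Measure.rnDeriv_withDensity _ hgm
  have hllr : llr (bernoulliMeasure (1 : ℝ) 0 p) (bernoulliMeasure (1 : ℝ) 0 q)
      =ᵐ[bernoulliMeasure (1 : ℝ) 0 p] fun x => Real.log (g x).toReal := by
    filter_upwards [hac.ae_le hrn] with x hx
    rw [llr, hx]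
  have hlog_int : Integrable (fun x => Real.log (g x).toReal) (bernoulliMeasure (1 : ℝ) 0 p) := by
    refine Integrable.of_bound (C := max |Real.log (ENNReal.ofReal (p / q)).toReal|
      |Real.log (ENNReal.ofReal ((1 - p) / (1 - q))).toReal|)
      (Real.measurable_log.comp hgm.ennreal_toReal).aestronglyMeasurable
      (ae_of_all _ fun x => ?_)
    simp only [hg, Real.norm_eq_abs]
    split_ifs
    · exact le_max_left _ _
    · exact le_max_right _ _
  rw [InformationTheory.klDiv_of_ac_of_integrable hac ((integrable_congr hllr).2 hlog_int),
    integral_congr_ae hllr, integral_bernoulliMeasure]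
  congr 1
  simp only [hg, if_true, zero_ne_one, if_false, probReal_univ, smul_eq_mul, add_sub_cancel_right]
  rw [ENNReal.toReal_ofReal (by positivity), ENNReal.toReal_ofReal (by positivity), klReal]

/-- Bernoulli laws are admissible competitors. The mean must exceed `x` strictly, so the bound is
obtained as a limit from the right. -/
lemma kInf_bernoulliMeasure_le {D : Set (Measure ℝ)}
    (hD : ∀ p : unitInterval, bernoulliMeasure (1 : ℝ) 0 p ∈ D) (p : unitInterval) {x : ℝ}
    (hx0 : 0 < x) (hx1 : x < 1) :
    kInf (bernoulliMeasure (1 : ℝ) 0 p) x D ≤ ENNReal.ofReal (klReal p x) := by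
  have h1 : ∀ q, x < q → q < 1 →
      kInf (bernoulliMeasure (1 : ℝ) 0 p) x D ≤ ENNReal.ofReal (klReal p q) := by
    intro q hxq hq1
    rw [← klDiv_bernoulliMeasure p ⟨q, (hx0.trans hxq).le, hq1.le⟩ (hx0.trans hxq) hq1, kInf]
    refine iInf₂_le_of_le _ (hD ⟨q, (hx0.trans hxq).le, hq1.le⟩) (iInf_le_of_le ?_ le_rfl)
    rw [integral_bernoulliMeasure]
    simpa using hxq
  have h2 : Tendsto (fun q => ENNReal.ofReal (klReal p q)) (nhdsWithin x (Set.Ioi x))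
      (nhds (ENNReal.ofReal (klReal p x))) :=
    ENNReal.tendsto_ofReal
      ((continuousAt_klReal_right p hx0 hx1).tendsto.mono_left nhdsWithin_le_nhds)
  refine ge_of_tendsto h2 ?_
  filter_upwards [Ioo_mem_nhdsGT hx1] with q hq using h1 q hq.1 hq.2

namespace Bandit

variable {K : ℕ} [NeZero K]

/-- A free `E` serves both comparisons. It needs control only for `μ* + ε < 1`: otherwise the
entropy on the left is infinite and its term vanishes. -/
lemma gapSum_le_four_mul (B : Bandit K) {ε : ℝ} (hε0 : 0 ≤ ε) (f : ℝ → ℝ)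
    (E : Fin K → ℝ≥0∞)
    (hE : ∀ a, B.optMean + ε < 1 → ε < B.gap a →
      E a ≤ ENNReal.ofReal (klReal (B.mean a) (B.optMean + ε))) :
    B.gapSum ε f (fun a => bernKL (B.mean a / (1 - ε)) (B.optMean / (1 - ε)))
      ≤ 4 * B.gapSum ε f E := by
  classical
  rw [gapSum, gapSum, Finset.mul_sum]
  refine Finset.sum_le_sum fun a ha => ?_
  have ha' : ε < B.gap a := (Finset.mem_filter.1 ha).2
  have hr : 0 < 1 - ε := sub_pos.2 (B.eps_lt_one_of_lt_gap ha')
  have hgap : B.mean a + ε < B.optMean := by unfold gap at ha'; linarith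
  have hm0 := B.mean_nonneg a
  have hopt1 := B.optMean_le_one
  rcases lt_or_ge (B.optMean + ε) 1 with hlt | hge
  · have hq0 : 0 < B.optMean / (1 - ε) := div_pos (by linarith) hr
    have hq1 : B.optMean / (1 - ε) < 1 := (div_lt_one hr).2 (by linarith)
    rw [bernKL_of_mem hq0 hq1]
    have h1 := klReal_add_le_four_mul hm0 hε0 hgap (by linarith)
    have h2 : E a ≤ 4 * ENNReal.ofReal (klReal (B.mean a / (1 - ε)) (B.optMean / (1 - ε))) := by
      refine (hE a hlt ha').trans ((ENNReal.ofReal_le_ofReal h1).trans (le_of_eq ?_))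
      rw [ENNReal.ofReal_mul (by norm_num)]
      norm_num
    generalize ENNReal.ofReal (klReal (B.mean a / (1 - ε)) (B.optMean / (1 - ε))) = d at h2 ⊢
    rw [div_eq_mul_inv, div_eq_mul_inv, mul_left_comm]
    gcongr
    rw [ENNReal.inv_le_iff_inv_le]
    refine le_trans (le_of_eq ?_) ((ENNReal.div_le_iff_le_mul (by simp) (by simp)).2
      (h2.trans (le_of_eq (mul_comm _ _))))
    rw [ENNReal.mul_inv (by simp) (by simp), inv_inv, mul_comm, div_eq_mul_inv]
  · have : bernKL (B.mean a / (1 - ε)) (B.optMean / (1 - ε)) = ∞ := by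
      rw [bernKL, if_pos]
      exact Or.inl ⟨(div_lt_one hr).2 (by linarith), (one_le_div hr).2 (by linarith)⟩
    rw [this, ENNReal.div_top]
    exact zero_le

end Bandit

end LenientBandit

end

/-! ### Assembly of the three claims -/

theorem mainTheorem1 :
    -- the asymptotic upper bound
    (∀ (K : ℕ) [NeZero K] (B : LenientBandit.Bandit K) (ε : ℝ) (f : ℝ → ℝ),
      LenientBandit.IsGapFunction ε f →
      limsup (fun T : ℕ => ENNReal.ofReal (B.lenientRegret ε f T / Real.log T)) atTop ≤
        B.gapSum ε f (fun a =>
          LenientBandit.bernKL (B.mean a / (1 - ε)) (B.optMean / (1 - ε)))) ∧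
    -- its order of magnitude, with an absolute constant
    (∃ C : ℝ≥0, ∀ (K : ℕ) [NeZero K] (B : LenientBandit.Bandit K) (ε : ℝ) (f : ℝ → ℝ),
      LenientBandit.IsGapFunction ε f →
      B.gapSum ε f (fun a =>
          LenientBandit.bernKL (B.mean a / (1 - ε)) (B.optMean / (1 - ε))) ≤
        C * B.gapSum ε f (fun a => LenientBandit.bernKL (B.mean a) (B.optMean + ε)) ∧
      -- for Bernoulli arms, this is the lower bound in terms of `kInf`
      ∀ D : Set (Measure ℝ), (∀ ν ∈ D, LenientBandit.IsUnitLaw ν) →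
        (∀ p : unitInterval, bernoulliMeasure (1 : ℝ) 0 p ∈ D) →
        (∀ a, ∃ p : unitInterval, B.law a = bernoulliMeasure (1 : ℝ) 0 p) →
        B.gapSum ε f (fun a =>
            LenientBandit.bernKL (B.mean a / (1 - ε)) (B.optMean / (1 - ε))) ≤
          C * B.gapSum ε f (fun a => LenientBandit.kInf (B.law a) (B.optMean + ε) D)) ∧
    -- bounded regret if the optimal mean exceeds `1 - ε`; the constant depends only on
    -- `ε` and the means of the arms
    (∀ (K : ℕ) [NeZero K] (ε : ℝ) (m : Fin K → ℝ), ∃ M : ℝ,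
      ∀ (B : LenientBandit.Bandit K) (f : ℝ → ℝ), (∀ a, B.mean a = m a) →
        LenientBandit.IsGapFunction ε f → 1 - ε < B.optMean →
        ∀ T : ℕ, B.lenientRegret ε f T ≤ M * ⨆ a, f (B.gap a)) := by
  refine ⟨fun K _ B ε f hf => B.limsup_lenientRegret_le hf, ⟨4, fun K _ B ε f hf => ?_⟩,
    fun K _ ε m => ?_⟩
  · have hpos : ∀ a, ε < B.gap a → 0 < B.optMean + ε := fun a ha => by
      have h1 := hf.eps_mem.1
      have h2 := B.mean_nonneg a
      unfold LenientBandit.Bandit.gap at ha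
      linarith
    refine ⟨?_, fun D _ hD hB => ?_⟩
    · exact B.gapSum_le_four_mul hf.eps_mem.1 f _ fun a hlt ha =>
        (LenientBandit.bernKL_of_mem (hpos a ha) hlt).le
    · refine B.gapSum_le_four_mul hf.eps_mem.1 f _ fun a hlt ha => ?_
      obtain ⟨p, hp⟩ := hB a
      have hmean : B.mean a = p := by
        rw [LenientBandit.Bandit.mean, hp, integral_bernoulliMeasure]
        simp
      rw [hp, hmean]
      exact LenientBandit.kInf_bernoulliMeasure_le hD p (hpos a ha) hlt
  -- `M` precedes the bandit, so any bandit with these means is used to produce it; if there is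
  -- none, the claim is vacuous.
  · by_cases hex : ∃ B : LenientBandit.Bandit K, (∀ a, B.mean a = m a) ∧ 1 - ε < B.optMean
    · obtain ⟨B, hB, hopt⟩ := hex
      obtain ⟨M, hM⟩ := B.exists_lenientRegret_le hopt
      exact ⟨M, fun B' f hB' hf _ => hM B' f (fun a => (hB' a).trans (hB a).symm) hf⟩
    · exact ⟨0, fun B' f hB' _ hopt => absurd ⟨B', hB', hopt⟩ hex⟩
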